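/- **Setting.** Let $\mathcal R$ be a database schema, i.e. a finite set of relation names, each with a tuple of attributes, and let $\mathbf D$ be a set of values. An $R$-tuple is a function from the attributes of $R$ to $\mathbf D$, and its type is $R$; $\mathrm{tuples}(\mathcal R)$ is the set of all $R$-tuples with $R\in\mathcal R$. A stream is an infinite sequence $S=S[0]S[1]\dots$ of elements of $\mathrm{tuples}(\mathcal R)$. An FO predicate of arity $n$ is a set $P\subseteq \mathrm{tuples}(\mathcal R)^n$; an SO predicate of arity $n$ is a set $P\subseteq (2^{\mathrm{tuples}(\mathcal R)})^n$. The universal extension $P^e$ of an FO predicate $P$ is the SO predicate of the same arity with $(A_1,\dots,A_n)\in P^e$ iff $A_1\times\dots\times A_n\subseteq P$; and $\mathcal B^e=\{P^e\mid P\in\mathcal B\}$. **FO-CEL.** Let $X$ be a set of first-order variables. The formulas of FO-CEL$(\mathcal B)$ are $\varphi ::= R\ \mathtt{AS}\ x \mid \varphi\ \mathtt{FILTER}\ P(x_1,\dots,x_n)\mid \varphi\ \mathtt{OR}\ \varphi\mid \varphi\,;\varphi\mid\varphi+$ with $R\in\mathcal R$, $P\in\mathcal B$ of arity $n$ and $x,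 x_i\in X$. Write $\mathrm{vdef}_+(\varphi)$ for the variables that are introduced by some $R\ \mathtt{AS}\ x$ outside the scope of every $+$. For a valuation $\nu:X\to\mathbb N$, the set $[\![\varphi]\!](S,i,j,\nu)$ of finite sets $M\subseteq\mathbb N$ (matches) is the least solution of: - $[\![R\ \mathtt{AS}\ x]\!](S,i,j,\nu)=\{\{\nu(x)\}\mid i\le\nu(x)=j,\ \mathrm{type}(S[\nu(x)])=R\}$; - $\mathtt{FILTER}\ P(x_1,\dots,x_n)$ keeps the matches if $(S[\nu(x_1)],\dots,S[\nu(x_n)])\in P$ and has none otherwise; $\mathtt{OR}$ is union; - $[\![\varphi_1;\varphi_2]\!](S,i,j,\nu)=\{M_1\cup M_2\mid \exists k.\ M_1\in[\![\varphi_1]\!](S,i,k,\nu),\ M_2\in[\![\varphi_2]\!](S,k+1,j,\nu),\ \max M_1<\min M_2\}$; - $[\![\varphi+]\!](S,i,j,\nu)=\bigcup_{\nu'}\big([\![\varphi]\!](S,i,j,\nu[\nu'/U])\cup[\![\varphi;\varphi+]\!](S,i,j,\nu[\nu'/U])\big)$ with $U=\mathrm{vdef}_+(\varphi)$, where $\nu[\nu'/U]$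 equals $\nu'$ on $U$ and $\nu$ elsewhere. Put $[\![\varphi]\!]_n(S)=\bigcup_\nu[\![\varphi]\!](S,0,n,\nu)$; $\varphi$ is satisfiable if some $[\![\varphi]\!]_n(S)$ is non-empty. Let $\mathrm{bound}(R\ \mathtt{AS}\ x)=\{x\}$, $\mathrm{bound}(\varphi\ \mathtt{FILTER}\ \alpha)=\mathrm{bound}(\varphi)$, $\mathrm{bound}(\varphi_1\ \mathtt{OR}\ \varphi_2)=\mathrm{bound}(\varphi_1)\cap\mathrm{bound}(\varphi_2)$, $\mathrm{bound}(\varphi_1;\varphi_2)=\mathrm{bound}(\varphi_1)\cup\mathrm{bound}(\varphi_2)$, $\mathrm{bound}(\varphi+)=\emptyset$. A formula is *well-formed* if for every filter in it and every variable $x$ of this filter, some subformula $\rho$ that contains the filter has $x\in\mathrm{bound}(\rho)$, and $x\notin\mathrm{vdef}_+(\sigma)$ for every subformula $\sigma+$ of $\rho$ whose body $\sigma$ contains the filter. It is *safe* if $\mathrm{vdef}_+(\varphi_1)\cap\mathrm{vdef}_+(\varphi_2)=\emptyset$ for every subformula $\varphi_1;\varphi_2$. **SO-CEL.** Let $\mathbf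 L$ be a finite set of labels with $\mathcal R\subseteq\mathbf L$. The formulas of SO-CEL$(\mathcal P)$ over $\mathbf L$ are $\psi::=R\mid\psi\ \mathtt{IN}\ A\mid\psi[A\to B]\mid\psi\ \mathtt{FILTER}\ P(A_1,\dots,A_n)\mid\psi\ \mathtt{OR}\ \psi\mid\psi\,;\psi\mid\psi+$ with $A,B,A_i\in\mathbf L$ and $P\in\mathcal P$ of arity $n$. A complex event $C$ assigns a finite set $C(A)\subseteq\mathbb N$ to each $A\in\mathbf L$, and $\mathrm{supp}(C)=\bigcup_A C(A)$. The set $[\![\psi]\!](S,i,j)$ of complex events is the least solution of: $[\![R]\!](S,i,j)$ contains just the complex event $\{(R,j)\}$ if $i\le j$ and $\mathrm{type}(S[j])=R$, and is empty otherwise; $\mathtt{IN}\ A$ replaces $C(A)$ by $\mathrm{supp}(C)$; $[A\to B]$ replaces $C(B)$ by $C(A)\cup C(B)$ and $C(A)$ by $\emptyset$ (nothing changes if $A=B$); $\mathtt{FILTER}\ P(A_1,\dots,A_n)$ keeps those $C$ with $(C_S(A_1),\dots,C_S(A_n))\in P$, where $C_S(A)=\{S[p]\mid p\in C(A)\}$;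 $\mathtt{OR}$ is union; $[\![\psi_1;\psi_2]\!](S,i,j)$ consists of the label-wise unions of $C_1\in[\![\psi_1]\!](S,i,k)$ and $C_2\in[\![\psi_2]\!](S,k+1,j)$, for any $k$, such that every position of $\mathrm{supp}(C_1)$ is smaller than every position of $\mathrm{supp}(C_2)$; and $[\![\psi+]\!]=[\![\psi]\!]\cup[\![\psi;\psi+]\!]$. Put $[\![\psi]\!]_n(S)=[\![\psi]\!](S,0,n)$. An FO-CEL formula $\varphi$ and an SO-CEL formula $\psi$ are *equivalent* if $[\![\varphi]\!]_n(S)=\{\mathrm{supp}(C)\mid C\in[\![\psi]\!]_n(S)\}$ for every stream $S$ and every $n\in\mathbb N$. **Theorem.** 1. Let $\mathcal B$ be a set of FO predicates of arity at most two (in particular, any set of binary predicates). For every well-formed formula $\varphi$ of FO-CEL$(\mathcal B)$ that is safe or satisfiable there are a finite label set $\mathbf L\supseteq\mathcal R$ and a formula $\psi$ of SO-CEL$(\mathcal B^e)$ over $\mathbf L$ that is equivalent to $\varphi$. 2. There are a schema, a binary FO predicate $P$ and a formula of SO-CEL$(\{P\}^e)$ that is not equivalent to any formula of FO-CEL$(\{P\})$.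 Hence SO-CEL is strictly more expressive than FO-CEL over binary predicates. -/

import Mathlib

universe a d u v

/-! ### Schemas, events and streams -/

/-- A database schema over the attribute names `Att`: a finite set of relation names, each with a
tuple of attributes. -/
structure CerSchema (Att : Type a) where
  /-- The relation names. -/
  Rel : Type u
  finite_rel : Finite Rel
  /-- The attributes of a relation name. -/
  att : Rel → List Att

/-- The set `tuples(R)` of all functions from the attributes of `R` to the values `Val`. -/
abbrev CerSchema.TuplesOf {Att : Type a} (𝓡 : CerSchema.{a, u} Att) (Val : Type d) (R : 𝓡.Rel) :
    Type (max a d) :=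
  {x : Att // x ∈ 𝓡.att R} → Val

/-- The set of all tuples of all relation names; the first component of a tuple is its type. -/
abbrev CerSchema.Tuples {Att : Type a} (𝓡 : CerSchema.{a, u} Att) (Val : Type d) :
    Type (max a d u) :=
  Σ R : 𝓡.Rel, 𝓡.TuplesOf Val R

/-- A stream is an infinite sequence of tuples; `S i` is the event at position `i`. -/
abbrev CerSchema.Streams {Att : Type a} (𝓡 : CerSchema.{a, u} Att) (Val : Type d) :
    Type (max a d u) :=
  ℕ → 𝓡.Tuples Val

/-! ### Predicates -/

/-- A first-order predicate of some arity `n`: a set of `n`-tuples of events. -/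
structure FOPredicate (T : Type u) where
  arity : ℕ
  rel : Set (Fin arity → T)

/-- A second-order predicate of some arity `n`: a set of `n`-tuples of sets of events. -/
structure SOPredicate (T : Type u) where
  arity : ℕ
  rel : Set (Fin arity → Set T)

/-- The universal extension `Pᵉ`: `(A₁, …, Aₙ) ∈ Pᵉ` iff `A₁ × ⋯ × Aₙ ⊆ P`. -/
def FOPredicate.ext {T : Type u} (P : FOPredicate T) : SOPredicate T where
  arity := P.arity
  rel := {A | ∀ t : Fin P.arity → T, (∀ i, t i ∈ A i) → t ∈ P.rel}

/-- The set `𝓟ᵉ` of the universal extensions of the predicates in `𝓟`. -/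
def FOPredicate.extSet {T : Type u} (𝓟 : Set (FOPredicate T)) : Set (SOPredicate T) :=
  FOPredicate.ext '' 𝓟

/-! ### First-order complex event logic -/

/-- The formulas of `FO-CEL(𝓟)` with first-order variables in `X`. -/
inductive FOCEL {Att : Type a} (𝓡 : CerSchema.{a, u} Att) (Val : Type d) (X : Type v)
    (𝓟 : Set (FOPredicate (𝓡.Tuples Val))) : Type (max a d u v)
  /-- `R AS x` -/
  | as (R : 𝓡.Rel) (x : X)
  /-- `φ FILTER P(x₁, …, xₙ)` -/
  | filter (φ : FOCEL 𝓡 Val X 𝓟) (P : 𝓟) (x : Fin P.1.arity → X)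
  /-- `φ₁ OR φ₂` -/
  | or (φ₁ φ₂ : FOCEL 𝓡 Val X 𝓟)
  /-- `φ₁ ; φ₂` -/
  | seq (φ₁ φ₂ : FOCEL 𝓡 Val X 𝓟)
  /-- `φ+` -/
  | plus (φ : FOCEL 𝓡 Val X 𝓟)

namespace FOCEL

variable {Att : Type a} {𝓡 : CerSchema.{a, u} Att} {Val : Type d} {X : Type v}
  {𝓟 : Set (FOPredicate (𝓡.Tuples Val))}

/-- The variables that are defined by a clause `R AS x` outside the scope of every `+`. -/
def vdefPlus : FOCEL 𝓡 Val X 𝓟 → Set X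
  | as _ x => {x}
  | filter φ _ _ => vdefPlus φ
  | or φ₁ φ₂ => vdefPlus φ₁ ∪ vdefPlus φ₂
  | seq φ₁ φ₂ => vdefPlus φ₁ ∪ vdefPlus φ₂
  | plus _ => ∅

/-- The variables that are defined in every evaluation of the formula, outside the scope of
every `+`. -/
def bound : FOCEL 𝓡 Val X 𝓟 → Set X
  | as _ x => {x}
  | filter φ _ _ => bound φ
  | or φ₁ φ₂ => bound φ₁ ∩ bound φ₂
  | seq φ₁ φ₂ => bound φ₁ ∪ bound φ₂
  | plus _ => ∅

/-- `WellFormedIn V φ`: every variable of a filter of `φ` is in `V` or bound in a subformula that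
contains the filter. Since the operator `+` re-binds the variables in `vdefPlus` of its body,
these have to be bound within the body. -/
def WellFormedIn : Set X → FOCEL 𝓡 Val X 𝓟 → Prop
  | _, as _ _ => True
  | V, filter φ _ x => (∀ i, x i ∈ V ∪ bound φ) ∧ WellFormedIn (V ∪ bound φ) φ
  | V, or φ₁ φ₂ =>
      WellFormedIn (V ∪ bound φ₁ ∩ bound φ₂) φ₁ ∧ WellFormedIn (V ∪ bound φ₁ ∩ bound φ₂) φ₂
  | V, seq φ₁ φ₂ =>
      WellFormedIn (V ∪ (bound φ₁ ∪ bound φ₂)) φ₁ ∧ WellFormedIn (V ∪ (bound φ₁ ∪ bound φ₂)) φ₂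
  | V, plus φ => WellFormedIn (V \ vdefPlus φ) φ

/-- Every variable of every filter is bound, in its own scope, by a subformula that contains the
filter. -/
def WellFormed (φ : FOCEL 𝓡 Val X 𝓟) : Prop := WellFormedIn ∅ φ

/-- In every subformula `φ₁ ; φ₂`, the two parts define different variables (outside of `+`). -/
def Safe : FOCEL 𝓡 Val X 𝓟 → Prop
  | as _ _ => True
  | filter φ _ _ => Safe φ
  | or φ₁ φ₂ => Safe φ₁ ∧ Safe φ₂
  | seq φ₁ φ₂ => Disjoint (vdefPlus φ₁) (vdefPlus φ₂) ∧ Safe φ₁ ∧ Safe φ₂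
  | plus φ => Safe φ

open Classical in
/-- The valuation `ν[ν'/U]`, equal to `ν'` on `U` and to `ν` elsewhere. -/
noncomputable def override (ν ν' : X → ℕ) (U : Set X) : X → ℕ :=
  fun x => if x ∈ U then ν' x else ν x

/-- `Sem S φ i j ν M` says `M ∈ ⟦φ⟧(S, i, j, ν)`. A match `M` is a finite set of positions, and the
concatenation of `M₁` and `M₂` is their union, defined when `max M₁ < min M₂`. -/
inductive Sem (S : 𝓡.Streams Val) : FOCEL 𝓡 Val X 𝓟 → ℕ → ℕ → (X → ℕ) → Finset ℕ → Prop
  | as {R : 𝓡.Rel} {x : X} {i j : ℕ} {ν : X → ℕ} :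
      i ≤ ν x → ν x = j → (S (ν x)).1 = R → Sem S (as R x) i j ν {ν x}
  | filter {φ : FOCEL 𝓡 Val X 𝓟} {P : 𝓟} {x : Fin P.1.arity → X} {i j : ℕ} {ν : X → ℕ}
      {M : Finset ℕ} :
      Sem S φ i j ν M → (fun m => S (ν (x m))) ∈ P.1.rel → Sem S (filter φ P x) i j ν M
  | or_left {φ₁ φ₂ : FOCEL 𝓡 Val X 𝓟} {i j : ℕ} {ν : X → ℕ} {M : Finset ℕ} :
      Sem S φ₁ i j ν M → Sem S (or φ₁ φ₂) i j ν M
  | or_right {φ₁ φ₂ : FOCEL 𝓡 Val X 𝓟} {i j : ℕ} {ν : X → ℕ} {M : Finset ℕ} :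
      Sem S φ₂ i j ν M → Sem S (or φ₁ φ₂) i j ν M
  | seq {φ₁ φ₂ : FOCEL 𝓡 Val X 𝓟} {i j k : ℕ} {ν : X → ℕ} {M₁ M₂ : Finset ℕ} :
      Sem S φ₁ i k ν M₁ → Sem S φ₂ (k + 1) j ν M₂ → (∀ p ∈ M₁, ∀ q ∈ M₂, p < q) →
      Sem S (seq φ₁ φ₂) i j ν (M₁ ∪ M₂)
  | plus_one {φ : FOCEL 𝓡 Val X 𝓟} {i j : ℕ} {ν : X → ℕ} {M : Finset ℕ} (ν' : X → ℕ) :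
      Sem S φ i j (override ν ν' φ.vdefPlus) M → Sem S (plus φ) i j ν M
  | plus_step {φ : FOCEL 𝓡 Val X 𝓟} {i j : ℕ} {ν : X → ℕ} {M : Finset ℕ} (ν' : X → ℕ) :
      Sem S (seq φ (plus φ)) i j (override ν ν' φ.vdefPlus) M → Sem S (plus φ) i j ν M

/-- The evaluation `⟦φ⟧ₙ(S)` at position `n`: the matches from position `0` to position `n`, for
some valuation. -/
def eval (φ : FOCEL 𝓡 Val X 𝓟) (S : 𝓡.Streams Val) (n : ℕ) : Set (Finset ℕ) :=
  {M | ∃ ν : X → ℕ, Sem S φ 0 n ν M}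

/-- The formula has an output on some stream at some position. -/
def Satisfiable (φ : FOCEL 𝓡 Val X 𝓟) : Prop :=
  ∃ (S : 𝓡.Streams Val) (n : ℕ), (φ.eval S n).Nonempty

end FOCEL

/-! ### Second-order complex event logic -/

/-- A finite set of second-order variables (labels) that contains all relation names. -/
structure LabelSet {Att : Type a} (𝓡 : CerSchema.{a, u} Att) where
  /-- The labels. -/
  Label : Type u
  fintype_label : Fintype Label
  /-- The relation names as labels. -/
  ofRel : 𝓡.Rel ↪ Label

instance LabelSet.instFintypeLabel {Att : Type a} {𝓡 : CerSchema.{a, u} Att} (Λ : LabelSet 𝓡) :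
    Fintype Λ.Label := Λ.fintype_label

/-- The formulas of `SO-CEL(𝓟)` with labels in `Λ`. -/
inductive SOCEL {Att : Type a} (𝓡 : CerSchema.{a, u} Att) (Val : Type d) (Λ : LabelSet 𝓡)
    (𝓟 : Set (SOPredicate (𝓡.Tuples Val))) : Type (max a d u)
  /-- `R` -/
  | rel (R : 𝓡.Rel)
  /-- `φ IN A` -/
  | inLabel (φ : SOCEL 𝓡 Val Λ 𝓟) (A : Λ.Label)
  /-- `φ[A → B]` -/
  | rename (φ : SOCEL 𝓡 Val Λ 𝓟) (A B : Λ.Label)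
  /-- `φ FILTER P(A₁, …, Aₙ)` -/
  | filter (φ : SOCEL 𝓡 Val Λ 𝓟) (P : 𝓟) (A : Fin P.1.arity → Λ.Label)
  /-- `φ₁ OR φ₂` -/
  | or (φ₁ φ₂ : SOCEL 𝓡 Val Λ 𝓟)
  /-- `φ₁ ; φ₂` -/
  | seq (φ₁ φ₂ : SOCEL 𝓡 Val Λ 𝓟)
  /-- `φ+` -/
  | plus (φ : SOCEL 𝓡 Val Λ 𝓟)

/-- A complex event assigns a finite set of positions to every label. -/
abbrev ComplexEvent {Att : Type a} {𝓡 : CerSchema.{a, u} Att} (Λ : LabelSet 𝓡) : Type u :=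
  Λ.Label → Finset ℕ

namespace ComplexEvent

variable {Att : Type a} {𝓡 : CerSchema.{a, u} Att} {Λ : LabelSet 𝓡}

/-- The set of all positions mentioned in the complex event. -/
def supp (C : ComplexEvent Λ) : Finset ℕ := Finset.univ.biUnion C

open Classical in
/-- The complex event `{(A, j)}`. -/
noncomputable def single (A : Λ.Label) (j : ℕ) : ComplexEvent Λ :=
  fun B => if B = A then {j} else ∅

/-- The condition `max C₁ < min C₂` under which the concatenation is defined. -/
def Before (C₁ C₂ : ComplexEvent Λ) : Prop := ∀ p ∈ C₁.supp, ∀ q ∈ C₂.supp, p < q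

/-- The concatenation of two complex events. -/
def concat (C₁ C₂ : ComplexEvent Λ) : ComplexEvent Λ := fun A => C₁ A ∪ C₂ A

open Classical in
/-- The complex event `C[A]`, which in addition assigns the whole support to `A`. -/
noncomputable def extend (C : ComplexEvent Λ) (A : Λ.Label) : ComplexEvent Λ :=
  fun B => if B = A then C.supp else C B

open Classical in
/-- The complex event `C[A → B]`. For `A = B` it is `C`. -/
noncomputable def rename (C : ComplexEvent Λ) (A B : Λ.Label) : ComplexEvent Λ :=
  fun D => if D = B then C A ∪ C B else if D = A then ∅ else C D

/-- The set `C_S(A)` of the events of `S` at the positions in `C(A)`. -/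
def events {Val : Type d} (C : ComplexEvent Λ) (S : 𝓡.Streams Val) (A : Λ.Label) :
    Set (𝓡.Tuples Val) :=
  S '' (C A : Set ℕ)

end ComplexEvent

namespace SOCEL

variable {Att : Type a} {𝓡 : CerSchema.{a, u} Att} {Val : Type d} {Λ : LabelSet 𝓡}
  {𝓟 : Set (SOPredicate (𝓡.Tuples Val))}

/-- `Sem S φ i j C` says `C ∈ ⟦φ⟧(S, i, j)`. -/
inductive Sem (S : 𝓡.Streams Val) : SOCEL 𝓡 Val Λ 𝓟 → ℕ → ℕ → ComplexEvent Λ → Prop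
  | rel {R : 𝓡.Rel} {i j : ℕ} :
      i ≤ j → (S j).1 = R → Sem S (rel R) i j (ComplexEvent.single (Λ.ofRel R) j)
  | inLabel {φ : SOCEL 𝓡 Val Λ 𝓟} {A : Λ.Label} {i j : ℕ} {C : ComplexEvent Λ} :
      Sem S φ i j C → Sem S (inLabel φ A) i j (C.extend A)
  | rename {φ : SOCEL 𝓡 Val Λ 𝓟} {A B : Λ.Label} {i j : ℕ} {C : ComplexEvent Λ} :
      Sem S φ i j C → Sem S (rename φ A B) i j (C.rename A B)
  | filter {φ : SOCEL 𝓡 Val Λ 𝓟} {P : 𝓟} {A : Fin P.1.arity → Λ.Label} {i j : ℕ}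
      {C : ComplexEvent Λ} :
      Sem S φ i j C → (fun m => C.events S (A m)) ∈ P.1.rel → Sem S (filter φ P A) i j C
  | or_left {φ₁ φ₂ : SOCEL 𝓡 Val Λ 𝓟} {i j : ℕ} {C : ComplexEvent Λ} :
      Sem S φ₁ i j C → Sem S (or φ₁ φ₂) i j C
  | or_right {φ₁ φ₂ : SOCEL 𝓡 Val Λ 𝓟} {i j : ℕ} {C : ComplexEvent Λ} :
      Sem S φ₂ i j C → Sem S (or φ₁ φ₂) i j C
  | seq {φ₁ φ₂ : SOCEL 𝓡 Val Λ 𝓟} {i j k : ℕ} {C₁ C₂ : ComplexEvent Λ} :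
      Sem S φ₁ i k C₁ → Sem S φ₂ (k + 1) j C₂ → C₁.Before C₂ →
      Sem S (seq φ₁ φ₂) i j (C₁.concat C₂)
  | plus_one {φ : SOCEL 𝓡 Val Λ 𝓟} {i j : ℕ} {C : ComplexEvent Λ} :
      Sem S φ i j C → Sem S (plus φ) i j C
  | plus_step {φ : SOCEL 𝓡 Val Λ 𝓟} {i j : ℕ} {C : ComplexEvent Λ} :
      Sem S (seq φ (plus φ)) i j C → Sem S (plus φ) i j C

/-- The evaluation `⟦φ⟧ₙ(S)` at position `n`. -/
def eval (φ : SOCEL 𝓡 Val Λ 𝓟) (S : 𝓡.Streams Val) (n : ℕ) : Set (ComplexEvent Λ) :=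
  {C | Sem S φ 0 n C}

end SOCEL

/-- A first-order and a second-order formula are equivalent if, on every stream and at every
position, the matches of the former are the supports of the complex events of the latter. -/
def CelEquiv {Att : Type a} {𝓡 : CerSchema.{a, u} Att} {Val : Type d} {X : Type v} {Λ : LabelSet 𝓡}
    {𝓟 : Set (FOPredicate (𝓡.Tuples Val))} {𝓠 : Set (SOPredicate (𝓡.Tuples Val))}
    (φ : FOCEL 𝓡 Val X 𝓟) (ψ : SOCEL 𝓡 Val Λ 𝓠) : Prop :=
  ∀ (S : 𝓡.Streams Val) (n : ℕ), φ.eval S n = ComplexEvent.supp '' ψ.eval S n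

/-! Part 1. After renaming (`tag`), every variable determines its depth, the number of `+` around
its definition; the whole formula counts as a body of depth 0. For each evaluation of the body of an
iteration the translation guesses the set `A` of filter atoms that are used and the set `D` of
variables that are defined, and takes the disjunction over all guesses. Every argument of every atom
has its own label, and `R AS x` puts its position into the labels of those arguments of atoms of `A`
that are `x`.

A filter is not checked where it stands. It is checked as a universal extension at the end of the
innermost enclosing body that defines all its variables, whose depth is that of its shallowest
variable. There this variable has one position, while the label of a deeper variable has collected
positions from all iterations that assert the atom. With at most two arguments, the condition on the
product of the labels says exactly that the atom holds in each iteration; two deeper arguments would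
in addition be compared across iterations. This is the only use of the arity (`HoldsBelow.concat`),
and only completeness needs it. `Admissible` excludes guesses whose universal condition would be
vacuous because a variable is undefined.

Soundness (`TrSem.sound`) and completeness (`Sem.completeAt`) are inductions on the formula with an
inner induction on the iterations. The result is a finite list of second-order formulas; safety or
satisfiability makes it nonempty, so that its disjunction is a formula.

Part 2. A first-order match of size `m` rests on at most `c * m` comparisons, with `c` the number of
filters (`Sem.exists_few_comparisons`), whereas `R+ FILTER Pᵉ(R, R)` compares all pairs of
positions. On a long match some pair is never compared, and changing the stream at that pair
separates the two formulas. -/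

/-! ### Iterated concatenation -/

/-- The closure of a set of spans, each with a start, an end and an output, under the concatenation
of adjacent spans. -/
inductive SeqClosure {γ : Type*} (cat : γ → γ → γ) (bef : γ → γ → Prop) (Q : ℕ → ℕ → γ → Prop) :
    ℕ → ℕ → γ → Prop
  | one {i j : ℕ} {c : γ} : Q i j c → SeqClosure cat bef Q i j c
  | step {i k j : ℕ} {c₁ c₂ : γ} : Q i k c₁ → SeqClosure cat bef Q (k + 1) j c₂ → bef c₁ c₂ →
      SeqClosure cat bef Q i j (cat c₁ c₂)

/-- The order condition on the two parts of a concatenation of matches. -/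
def MatchBefore (M₁ M₂ : Finset ℕ) : Prop := ∀ p ∈ M₁, ∀ q ∈ M₂, p < q

/-! ### Inversion rules for the two semantics -/

namespace FOCEL

variable {Att : Type a} {𝓡 : CerSchema.{a, u} Att} {Val : Type d} {X : Type v}
  {𝓟 : Set (FOPredicate (𝓡.Tuples Val))} {S : 𝓡.Streams Val} {i j : ℕ} {ν : X → ℕ} {M : Finset ℕ}

theorem override_of_mem {ν ν' : X → ℕ} {U : Set X} {x : X} (h : x ∈ U) :
    override ν ν' U x = ν' x := if_pos h

theorem override_of_notMem {ν ν' : X → ℕ} {U : Set X} {x : X} (h : x ∉ U) :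
    override ν ν' U x = ν x := if_neg h

@[simp]
theorem override_override (ν ν' ν'' : X → ℕ) (U : Set X) :
    override (override ν ν' U) ν'' U = override ν ν'' U := by
  funext x
  by_cases h : x ∈ U <;> simp [override, h]

theorem override_self (ν : X → ℕ) (U : Set X) : override ν ν U = ν := by
  funext x
  simp [override]

theorem sem_as_iff {R : 𝓡.Rel} {x : X} :
    Sem S (as R x : FOCEL 𝓡 Val X 𝓟) i j ν M ↔
      i ≤ j ∧ ν x = j ∧ (S j).1 = R ∧ M = {j} := by
  constructor
  · intro h
    cases h with
    | as h₁ h₂ h₃ => subst h₂; exact ⟨h₁, rfl, h₃, rfl⟩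
  · rintro ⟨h₁, rfl, h₃, rfl⟩
    exact .as h₁ rfl h₃

theorem sem_filter_iff {φ : FOCEL 𝓡 Val X 𝓟} {P : 𝓟} {x : Fin P.1.arity → X} :
    Sem S (filter φ P x) i j ν M ↔ Sem S φ i j ν M ∧ (fun m => S (ν (x m))) ∈ P.1.rel := by
  constructor
  · intro h
    cases h with
    | filter h₁ h₂ => exact ⟨h₁, h₂⟩
  · exact fun h => .filter h.1 h.2

theorem sem_or_iff {φ₁ φ₂ : FOCEL 𝓡 Val X 𝓟} :
    Sem S (or φ₁ φ₂) i j ν M ↔ Sem S φ₁ i j ν M ∨ Sem S φ₂ i j ν M := by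
  constructor
  · intro h
    cases h with
    | or_left h => exact .inl h
    | or_right h => exact .inr h
  · exact fun h => h.elim .or_left .or_right

theorem sem_seq_iff {φ₁ φ₂ : FOCEL 𝓡 Val X 𝓟} :
    Sem S (seq φ₁ φ₂) i j ν M ↔ ∃ k M₁ M₂, Sem S φ₁ i k ν M₁ ∧ Sem S φ₂ (k + 1) j ν M₂ ∧
      MatchBefore M₁ M₂ ∧ M = M₁ ∪ M₂ := by
  constructor
  · intro h
    cases h with
    | seq h₁ h₂ h₃ => exact ⟨_, _, _, h₁, h₂, h₃, rfl⟩
  · rintro ⟨k, M₁, M₂, h₁, h₂, h₃, rfl⟩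
    exact .seq h₁ h₂ h₃

/-- Each step overrides all of `vdefPlus` anew, so nested overrides collapse and every iteration
sees `ν` up to its own fresh values. Hence `+` is the closure of one fixed relation, open to
induction on the number of iterations. -/
theorem sem_plus_iff {φ : FOCEL 𝓡 Val X 𝓟} :
    Sem S (plus φ) i j ν M ↔ SeqClosure (· ∪ ·) MatchBefore
      (fun i j M => ∃ ν', Sem S φ i j (override ν ν' φ.vdefPlus) M) i j M := by
  constructor
  · intro h
    -- The premise of `plus_step` concerns `seq φ (plus φ)`, which is not a subformula. The
    -- induction is therefore on derivations, with a claim for both shapes.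
    suffices H : ∀ χ, Sem S χ i j ν M →
        (χ = plus φ → SeqClosure (· ∪ ·) MatchBefore
          (fun i j M => ∃ ν', Sem S φ i j (override ν ν' φ.vdefPlus) M) i j M) ∧
        (χ = seq φ (plus φ) → ∃ k M₁ M₂, Sem S φ i k ν M₁ ∧ SeqClosure (· ∪ ·) MatchBefore
          (fun i j M => ∃ ν', Sem S φ i j (override ν ν' φ.vdefPlus) M) (k + 1) j M₂ ∧
          MatchBefore M₁ M₂ ∧ M = M₁ ∪ M₂) from (H _ h).1 rfl
    clear h
    intro χ h
    induction h with
    | as => simp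
    | filter => simp
    | or_left => simp
    | or_right => simp
    | seq h₁ h₂ h₃ ih₁ ih₂ =>
      refine ⟨by simp, fun h => ?_⟩
      obtain ⟨rfl, rfl⟩ := seq.inj h
      exact ⟨_, _, _, h₁, ih₂.1 rfl, h₃, rfl⟩
    | plus_one ν' h =>
      refine ⟨fun h' => ?_, by simp⟩
      obtain rfl := plus.inj h'
      exact .one ⟨ν', h⟩
    | plus_step ν' h ih =>
      refine ⟨fun h' => ?_, by simp⟩
      obtain rfl := plus.inj h'
      obtain ⟨k, M₁, M₂, h₁, h₂, h₃, rfl⟩ := ih.2 rfl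
      simp only [override_override] at h₂
      exact .step ⟨ν', h₁⟩ h₂ h₃
  · intro h
    -- The tail of an iteration is evaluated under the override chosen by its head, so the claim has
    -- to cover all overrides.
    suffices H : ∀ ν', Sem S (plus φ) i j (override ν ν' φ.vdefPlus) M by
      simpa only [override_self] using H ν
    induction h with
    | one h =>
      obtain ⟨ν', h⟩ := h
      exact fun _ => .plus_one ν' (by rwa [override_override])
    | step h₁ _ h₃ ih =>
      obtain ⟨ν', h₁⟩ := h₁
      exact fun _ => .plus_step ν' (by rw [override_override]; exact .seq h₁ (ih ν') h₃)

end FOCEL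

namespace SOCEL

variable {Att : Type a} {𝓡 : CerSchema.{a, u} Att} {Val : Type d} {Λ : LabelSet 𝓡}
  {𝓟 : Set (SOPredicate (𝓡.Tuples Val))} {S : 𝓡.Streams Val} {i j : ℕ} {C : ComplexEvent Λ}

theorem sem_rel_iff {R : 𝓡.Rel} :
    Sem S (rel R : SOCEL 𝓡 Val Λ 𝓟) i j C ↔
      i ≤ j ∧ (S j).1 = R ∧ C = ComplexEvent.single (Λ.ofRel R) j := by
  constructor
  · intro h
    cases h with
    | rel h₁ h₂ => exact ⟨h₁, h₂, rfl⟩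
  · rintro ⟨h₁, h₂, rfl⟩
    exact .rel h₁ h₂

theorem sem_inLabel_iff {φ : SOCEL 𝓡 Val Λ 𝓟} {A : Λ.Label} :
    Sem S (inLabel φ A) i j C ↔ ∃ C', Sem S φ i j C' ∧ C = C'.extend A := by
  constructor
  · intro h
    cases h with
    | inLabel h => exact ⟨_, h, rfl⟩
  · rintro ⟨C', h, rfl⟩
    exact .inLabel h

theorem sem_filter_iff {φ : SOCEL 𝓡 Val Λ 𝓟} {P : 𝓟} {A : Fin P.1.arity → Λ.Label} :
    Sem S (filter φ P A) i j C ↔ Sem S φ i j C ∧ (fun m => C.events S (A m)) ∈ P.1.rel := by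
  constructor
  · intro h
    cases h with
    | filter h₁ h₂ => exact ⟨h₁, h₂⟩
  · exact fun h => .filter h.1 h.2

theorem sem_or_iff {φ₁ φ₂ : SOCEL 𝓡 Val Λ 𝓟} :
    Sem S (or φ₁ φ₂) i j C ↔ Sem S φ₁ i j C ∨ Sem S φ₂ i j C := by
  constructor
  · intro h
    cases h with
    | or_left h => exact .inl h
    | or_right h => exact .inr h
  · exact fun h => h.elim .or_left .or_right

theorem sem_seq_iff {φ₁ φ₂ : SOCEL 𝓡 Val Λ 𝓟} :
    Sem S (seq φ₁ φ₂) i j C ↔ ∃ k C₁ C₂, Sem S φ₁ i k C₁ ∧ Sem S φ₂ (k + 1) j C₂ ∧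
      C₁.Before C₂ ∧ C = C₁.concat C₂ := by
  constructor
  · intro h
    cases h with
    | seq h₁ h₂ h₃ => exact ⟨_, _, _, h₁, h₂, h₃, rfl⟩
  · rintro ⟨k, C₁, C₂, h₁, h₂, h₃, rfl⟩
    exact .seq h₁ h₂ h₃

theorem sem_plus_iff {φ : SOCEL 𝓡 Val Λ 𝓟} :
    Sem S (plus φ) i j C ↔
      SeqClosure ComplexEvent.concat ComplexEvent.Before (Sem S φ) i j C := by
  constructor
  · intro h
    suffices H : ∀ χ, Sem S χ i j C →
        (χ = plus φ → SeqClosure ComplexEvent.concat ComplexEvent.Before (Sem S φ) i j C) ∧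
        (χ = seq φ (plus φ) → ∃ k C₁ C₂, Sem S φ i k C₁ ∧
          SeqClosure ComplexEvent.concat ComplexEvent.Before (Sem S φ) (k + 1) j C₂ ∧
          C₁.Before C₂ ∧ C = C₁.concat C₂) from (H _ h).1 rfl
    clear h
    intro χ h
    induction h with
    | rel => simp
    | inLabel => simp
    | rename => simp
    | filter => simp
    | or_left => simp
    | or_right => simp
    | seq h₁ h₂ h₃ ih₁ ih₂ =>
      refine ⟨by simp, fun h => ?_⟩
      obtain ⟨rfl, rfl⟩ := seq.inj h
      exact ⟨_, _, _, h₁, ih₂.1 rfl, h₃, rfl⟩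
    | plus_one h =>
      refine ⟨fun h' => ?_, by simp⟩
      obtain rfl := plus.inj h'
      exact .one h
    | plus_step h ih =>
      refine ⟨fun h' => ?_, by simp⟩
      obtain rfl := plus.inj h'
      obtain ⟨k, C₁, C₂, h₁, h₂, h₃, rfl⟩ := ih.2 rfl
      exact .step h₁ h₂ h₃
  · intro h
    induction h with
    | one h => exact .plus_one h
    | step h₁ _ h₃ ih => exact .plus_step (.seq h₁ ih h₃)

end SOCEL

namespace ComplexEvent

variable {Att : Type a} {𝓡 : CerSchema.{a, u} Att} {Λ : LabelSet 𝓡}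

theorem mem_supp {C : ComplexEvent Λ} {p : ℕ} : p ∈ C.supp ↔ ∃ A, p ∈ C A := by
  simp [supp]

theorem supp_concat (C₁ C₂ : ComplexEvent Λ) : (C₁.concat C₂).supp = C₁.supp ∪ C₂.supp := by
  ext p
  simp [mem_supp, concat, exists_or]

end ComplexEvent

/-! ### A second-order formula without first-order equivalent -/

namespace FOCEL

variable {Att : Type a} {𝓡 : CerSchema.{a, u} Att} {Val : Type d} {X : Type v}
  {𝓟 : Set (FOPredicate (𝓡.Tuples Val))}

/-- The number of filters of the formula. -/
def numFilters : FOCEL 𝓡 Val X 𝓟 → ℕ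
  | as _ _ => 0
  | filter φ _ _ => numFilters φ + 1
  | or φ₁ φ₂ => numFilters φ₁ + numFilters φ₂
  | seq φ₁ φ₂ => numFilters φ₁ + numFilters φ₂
  | plus φ => numFilters φ

theorem Sem.nonempty {φ : FOCEL 𝓡 Val X 𝓟} {S : 𝓡.Streams Val} {i j : ℕ} {ν : X → ℕ}
    {M : Finset ℕ} (h : Sem S φ i j ν M) : M.Nonempty := by
  induction h with
  | as => simp
  | filter _ _ ih => exact ih
  | or_left _ ih => exact ih
  | or_right _ ih => exact ih
  | seq _ _ _ ih _ => exact ih.mono Finset.subset_union_left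
  | plus_one _ _ ih => exact ih
  | plus_step _ _ ih => exact ih

/-- A match is witnessed by linearly many evaluations of a binary predicate: it remains a match on
every other stream with the same types on which these evaluations succeed. -/
theorem Sem.exists_few_comparisons {P : FOPredicate (𝓡.Tuples Val)} (hP : P.arity = 2)
    {S : 𝓡.Streams Val} (φ : FOCEL 𝓡 Val X {P}) :
    ∀ {i j : ℕ} {ν : X → ℕ} {M : Finset ℕ}, Sem S φ i j ν M →
      ∃ E : Finset (ℕ × ℕ), E.card ≤ φ.numFilters * M.card ∧
        ∀ S' : 𝓡.Streams Val, (∀ p, (S' p).1 = (S p).1) →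
          (∀ p ∈ E, (fun m : Fin P.arity => if m.1 = 0 then S' p.1 else S' p.2) ∈ P.rel) →
            Sem S' φ i j ν M := by
  induction φ with
  | as R x =>
    intro i j ν M h
    rw [sem_as_iff] at h
    refine ⟨∅, by simp, fun S' hS' _ => ?_⟩
    rw [sem_as_iff, hS']
    exact h
  | filter φ Q x ih =>
    intro i j ν M h
    obtain ⟨Q, rfl⟩ := Q
    rw [sem_filter_iff] at h
    obtain ⟨E, hE, hS⟩ := ih h.1
    refine ⟨insert (ν (x ⟨0, by simp [hP]⟩), ν (x ⟨1, by simp [hP]⟩)) E, ?_, fun S' hS' hp => ?_⟩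
    -- The one new comparison is paid for by `1 ≤ M.card`.
    · have := h.1.nonempty.card_pos
      have := Finset.card_insert_le (ν (x ⟨0, by simp [hP]⟩), ν (x ⟨1, by simp [hP]⟩)) E
      simp only [numFilters]
      linarith
    · rw [sem_filter_iff]
      refine ⟨hS S' hS' fun p hE => hp p (Finset.mem_insert_of_mem hE), ?_⟩
      convert hp _ (Finset.mem_insert_self _ _) using 1
      funext m
      obtain ⟨m, hm⟩ := m
      have : m = 0 ∨ m = 1 := by have : m < 2 := hP ▸ hm; omega
      rcases this with rfl | rfl <;> simp
  | or φ₁ φ₂ ih₁ ih₂ =>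
    intro i j ν M h
    simp only [numFilters, add_mul]
    rcases sem_or_iff.1 h with h | h
    · obtain ⟨E, hE, hS⟩ := ih₁ h
      exact ⟨E, by linarith [Nat.zero_le (φ₂.numFilters * M.card)],
        fun S' hS' hp => .or_left (hS S' hS' hp)⟩
    · obtain ⟨E, hE, hS⟩ := ih₂ h
      exact ⟨E, by linarith [Nat.zero_le (φ₁.numFilters * M.card)],
        fun S' hS' hp => .or_right (hS S' hS' hp)⟩
  | seq φ₁ φ₂ ih₁ ih₂ =>
    intro i j ν M h
    obtain ⟨k, M₁, M₂, h₁, h₂, h₃, rfl⟩ := sem_seq_iff.1 h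
    obtain ⟨E₁, hE₁, hS₁⟩ := ih₁ h₁
    obtain ⟨E₂, hE₂, hS₂⟩ := ih₂ h₂
    refine ⟨E₁ ∪ E₂, ?_, fun S' hS' hp => .seq (hS₁ S' hS' fun p h => hp p (by simp [h]))
      (hS₂ S' hS' fun p h => hp p (by simp [h])) h₃⟩
    -- Ordered matches are disjoint, so their sizes add up.
    rw [Finset.card_union_of_disjoint
      (Finset.disjoint_left.2 fun p h h' => (h₃ p h p h').false)]
    simp only [numFilters]
    calc (E₁ ∪ E₂).card ≤ E₁.card + E₂.card := Finset.card_union_le _ _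
      _ ≤ φ₁.numFilters * M₁.card + φ₂.numFilters * M₂.card := by gcongr
      _ ≤ (φ₁.numFilters + φ₂.numFilters) * M₁.card +
          (φ₁.numFilters + φ₂.numFilters) * M₂.card := by gcongr <;> omega
      _ = _ := by ring
  | plus φ ih =>
    intro i j ν M h
    rw [sem_plus_iff] at h
    simp only [sem_plus_iff, numFilters]
    -- The number of iterations is unbounded, but each one pays for its comparisons with its own
    -- positions.
    induction h with
    | one h =>
      obtain ⟨ν', h⟩ := h
      obtain ⟨E, hE, hS⟩ := ih h
      exact ⟨E, hE, fun S' hS' hp => .one ⟨ν', hS S' hS' hp⟩⟩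
    | @step i k j M₁ M₂ h₁ _ h₃ ih₂ =>
      obtain ⟨ν', h₁⟩ := h₁
      obtain ⟨E₁, hE₁, hS₁⟩ := ih h₁
      obtain ⟨E₂, hE₂, hS₂⟩ := ih₂
      refine ⟨E₁ ∪ E₂, ?_, fun S' hS' hp => .step ⟨ν', hS₁ S' hS' fun p h => hp p (by simp [h])⟩
        (hS₂ S' hS' fun p h => hp p (by simp [h])) h₃⟩
      rw [Finset.card_union_of_disjoint
        (Finset.disjoint_left.2 fun p h h' => (h₃ p h p h').false), mul_add]
      exact (Finset.card_union_le _ _).trans (by gcongr)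

end FOCEL

/-! ### The counterexample -/

/-- The schema with one relation name, which has one attribute. -/
def unarySchema : CerSchema.{0, 0} ℕ := ⟨Unit, inferInstance, fun _ => [0]⟩

/-- The event with value `n` over `unarySchema`. -/
def unaryTuple (n : ℕ) : unarySchema.Tuples ℕ := ⟨(), fun _ => n⟩

/-- The value of an event over `unarySchema`. -/
def unaryValue (t : unarySchema.Tuples ℕ) : ℕ := t.2 ⟨0, List.mem_singleton.2 rfl⟩

@[simp]
theorem unaryValue_unaryTuple (n : ℕ) : unaryValue (unaryTuple n) = n := rfl

/-- The predicate stating that the second value is not the successor of the first. -/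
def notSuccPredicate : FOPredicate (unarySchema.Tuples ℕ) where
  arity := 2
  rel := {t | unaryValue (t 1) ≠ unaryValue (t 0) + 1}

/-- The label set of the relation names of `unarySchema` only. -/
def unaryLabels : LabelSet unarySchema :=
  ⟨Unit, inferInstance, Function.Embedding.refl Unit⟩

/-- The formula `R+ FILTER Pᵉ(R, R)` for `P = notSuccPredicate`. -/
def notSuccFormula : SOCEL unarySchema ℕ unaryLabels (FOPredicate.extSet {notSuccPredicate}) :=
  .filter (.plus (.rel (() : Unit))) ⟨notSuccPredicate.ext, notSuccPredicate, rfl, rfl⟩ fun _ => ()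

theorem unaryLabels_supp (C : ComplexEvent unaryLabels) : C.supp = C () := by
  ext p
  rw [ComplexEvent.mem_supp]
  exact ⟨fun ⟨_, h⟩ => h, fun h => ⟨_, h⟩⟩

theorem sem_plus_rel_Icc (𝓟 : Set (SOPredicate (unarySchema.Tuples ℕ)))
    (S : unarySchema.Streams ℕ) (n i : ℕ) :
    SOCEL.Sem S (.plus (.rel (() : Unit)) : SOCEL unarySchema ℕ unaryLabels 𝓟) i (i + n)
      (fun _ => Finset.Icc i (i + n)) := by
  have single (i j : ℕ) (h : i ≤ j) :
      SOCEL.Sem S (.rel (() : Unit) : SOCEL unarySchema ℕ unaryLabels 𝓟) i j (fun _ => {j}) := by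
    refine SOCEL.sem_rel_iff.2 ⟨h, rfl, ?_⟩
    funext x
    exact (if_pos rfl).symm
  induction n generalizing i with
  | zero => simpa using SOCEL.Sem.plus_one (single i i le_rfl)
  | succ n ih =>
    have h := SOCEL.Sem.plus_step (.seq (single i i le_rfl) (ih (i + 1)) ?_)
    · have e : i + 1 + n = i + (n + 1) := by ring
      rw [e] at h
      convert h using 1
      funext x
      ext p
      simp only [Finset.mem_Icc, ComplexEvent.concat, Finset.mem_union, Finset.mem_singleton]
      omega
    · intro p hp q hq
      rw [unaryLabels_supp] at hp hq
      simp only [Finset.mem_singleton, Finset.mem_Icc] at hp hq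
      omega

theorem mem_ext_notSuccPredicate (C : ComplexEvent unaryLabels) (S : unarySchema.Streams ℕ) :
    (fun _ => C.events S ()) ∈ notSuccPredicate.ext.rel ↔
      ∀ p ∈ C (), ∀ q ∈ C (), unaryValue (S q) ≠ unaryValue (S p) + 1 := by
  constructor
  · intro h p hp q hq
    exact h (fun m : Fin 2 => if m = 0 then S p else S q) fun m => by
      by_cases hm : m = (0 : Fin 2)
      · exact ⟨p, hp, (if_pos hm).symm⟩
      · exact ⟨q, hq, (if_neg hm).symm⟩
  · intro h t ht
    obtain ⟨p, hp, hp'⟩ := ht (0 : Fin 2)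
    obtain ⟨q, hq, hq'⟩ := ht (1 : Fin 2)
    have := h p hp q hq
    rwa [hp', hq'] at this

/-- A match on `N + 1` positions has `N * (N + 1)` ordered pairs of distinct positions but needs at
most `(N - 1) * (N + 1)` comparisons. Making an uncompared pair violate the predicate preserves the
first-order match and destroys the second-order one. -/
theorem not_celEquiv_notSuccFormula {X : Type v} (φ : FOCEL unarySchema ℕ X {notSuccPredicate}) :
    ¬ CelEquiv φ notSuccFormula := by
  intro heq
  set N := φ.numFilters + 1 with hN
  -- Multiples of 3 leave room: `3 * p + 1` is the successor of `3 * p` only, and neither its own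
  -- successor nor any two multiples of 3 produce another violation.
  let S : unarySchema.Streams ℕ := fun i => unaryTuple (3 * i)
  have hM : Finset.Icc 0 N ∈ φ.eval S N := by
    rw [heq]
    refine ⟨fun _ => Finset.Icc 0 N, SOCEL.sem_filter_iff.2 ⟨?_, ?_⟩, unaryLabels_supp _⟩
    · simpa using sem_plus_rel_Icc _ S N 0
    · refine (mem_ext_notSuccPredicate _ _).2 fun p _ q _ => ?_
      simp only [S, unaryValue_unaryTuple]
      omega
  obtain ⟨ν, hν⟩ := hM
  obtain ⟨E, hE, hS⟩ := FOCEL.Sem.exists_few_comparisons rfl φ hν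
  obtain ⟨⟨p, q⟩, hpq, hpqE⟩ : ∃ r ∈ (Finset.Icc 0 N).offDiag, r ∉ E := by
    by_contra! h
    have := Finset.card_le_card (show (Finset.Icc 0 N).offDiag ⊆ E from h)
    rw [Finset.offDiag_card] at this
    simp only [Nat.card_Icc] at hE this
    have h₂ : (N + 1 - 0) * (N + 1 - 0) - (N + 1 - 0) = N * (N + 1) := by
      simp [Nat.add_mul, Nat.mul_add]
    rw [h₂] at this
    have h₃ := this.trans hE
    rw [hN] at h₃
    simp only [Nat.sub_zero] at h₃
    nlinarith
  rw [Finset.mem_offDiag] at hpq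
  -- After this change `(p, q)` is the only violating pair of positions.
  let S' : unarySchema.Streams ℕ := fun i => if i = q then unaryTuple (3 * p + 1) else S i
  have hval (i : ℕ) : unaryValue (S' i) = if i = q then 3 * p + 1 else 3 * i := by
    by_cases hi : i = q <;> simp [S', S, hi]
  have hS' : Finset.Icc 0 N ∈ φ.eval S' N := by
    refine ⟨ν, hS S' (fun _ => rfl) fun r hr => ?_⟩
    change unaryValue (S' r.2) ≠ unaryValue (S' r.1) + 1
    rw [hval, hval]
    split_ifs with h₁ h₂ h₂
    · omega
    · intro h
      have : r = (p, q) := Prod.ext (by simp only; omega) h₁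
      exact hpqE (this ▸ hr)
    · omega
    · omega
  rw [heq] at hS'
  obtain ⟨C, hC, hsupp⟩ := hS'
  rw [unaryLabels_supp] at hsupp
  -- The only label carries the whole support, so the filter must compare `p` with `q`.
  have := (mem_ext_notSuccPredicate _ _).1 (SOCEL.sem_filter_iff.1 hC).2 p (hsupp ▸ hpq.1) q
    (hsupp ▸ hpq.2.1)
  rw [hval, hval, if_pos rfl, if_neg hpq.2.2] at this
  exact this rfl

/-! ### Auxiliary second-order formulas -/

namespace SOCEL

variable {Att : Type a} {𝓡 : CerSchema.{a, u} Att} {Val : Type d} {Λ : LabelSet 𝓡}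
  {𝓟 : Set (SOPredicate (𝓡.Tuples Val))} {S : 𝓡.Streams Val} {i j : ℕ} {C : ComplexEvent Λ}

/-- The formula `(… (φ IN A₁) …) IN Aₙ`. -/
def inLabels (φ : SOCEL 𝓡 Val Λ 𝓟) : List Λ.Label → SOCEL 𝓡 Val Λ 𝓟
  | [] => φ
  | A :: l => inLabel (inLabels φ l) A

/-- The disjunction of the formulas of a nonempty list. -/
def orList : SOCEL 𝓡 Val Λ 𝓟 → List (SOCEL 𝓡 Val Λ 𝓟) → SOCEL 𝓡 Val Λ 𝓟
  | φ, [] => φ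
  | φ, χ :: l => or φ (orList χ l)

/-- The iteration of the disjunction of a list of formulas, if the list is nonempty. -/
def plusList : List (SOCEL 𝓡 Val Λ 𝓟) → List (SOCEL 𝓡 Val Λ 𝓟)
  | [] => []
  | φ :: l => [plus (orList φ l)]

-- Each `IN` adds a label holding the current support, which stays `{j}` throughout.
open Classical in
theorem sem_inLabels_rel_iff {R : 𝓡.Rel} {l : List Λ.Label} :
    Sem S (inLabels (rel R : SOCEL 𝓡 Val Λ 𝓟) l) i j C ↔
      i ≤ j ∧ (S j).1 = R ∧ C = fun B => if B = Λ.ofRel R ∨ B ∈ l then {j} else ∅ := by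
  induction l generalizing C with
  | nil =>
    simp only [inLabels, sem_rel_iff, List.not_mem_nil, or_false]
    rfl
  | cons A l ih =>
    have key : (fun B => if B = Λ.ofRel R ∨ B ∈ A :: l then {j} else ∅ : ComplexEvent Λ) =
        ComplexEvent.extend (fun B => if B = Λ.ofRel R ∨ B ∈ l then {j} else ∅) A := by
      funext B
      by_cases hB : B = A
      · have : ComplexEvent.supp
            (fun B => if B = Λ.ofRel R ∨ B ∈ l then {j} else ∅ : ComplexEvent Λ) = {j} := by
          ext p
          rw [ComplexEvent.mem_supp, Finset.mem_singleton]
          constructor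
          · rintro ⟨D, hD⟩
            by_cases h : D = Λ.ofRel R ∨ D ∈ l
            · simpa [h] using hD
            · simp [h] at hD
          · rintro rfl
            exact ⟨Λ.ofRel R, by simp⟩
        simp [ComplexEvent.extend, hB, this]
      · simp [ComplexEvent.extend, hB]
    simp only [inLabels, sem_inLabel_iff, ih, key]
    constructor
    · rintro ⟨C', ⟨h₁, h₂, rfl⟩, rfl⟩
      exact ⟨h₁, h₂, rfl⟩
    · rintro ⟨h₁, h₂, rfl⟩
      exact ⟨_, ⟨h₁, h₂, rfl⟩, rfl⟩

theorem sem_orList_iff {φ : SOCEL 𝓡 Val Λ 𝓟} {l : List (SOCEL 𝓡 Val Λ 𝓟)} :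
    Sem S (orList φ l) i j C ↔ ∃ χ ∈ φ :: l, Sem S χ i j C := by
  induction l generalizing φ with
  | nil => simp [orList]
  | cons χ l ih => rw [orList, sem_or_iff, ih, List.exists_mem_cons_iff (l := χ :: l)]

/-- An empty list of alternatives has no disjunction to iterate, but the closure of the empty
relation is empty as well. -/
theorem exists_sem_plusList_iff {l : List (SOCEL 𝓡 Val Λ 𝓟)} :
    (∃ χ ∈ plusList l, Sem S χ i j C) ↔
      SeqClosure ComplexEvent.concat ComplexEvent.Before
        (fun i j C => ∃ χ ∈ l, Sem S χ i j C) i j C := by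
  cases l with
  | nil =>
    simp only [plusList, List.not_mem_nil, false_and, exists_false, false_iff]
    intro h
    cases h <;> assumption
  | cons φ l =>
    simp only [plusList, List.mem_singleton, exists_eq_left, sem_plus_iff]
    simp only [← sem_orList_iff]

theorem plusList_ne_nil {l : List (SOCEL 𝓡 Val Λ 𝓟)} (h : l ≠ []) : plusList l ≠ [] := by
  cases l with
  | nil => exact absurd rfl h
  | cons φ l => simp [plusList]

end SOCEL

/-! ### The translation -/

namespace FOCEL

variable {Att : Type a} {𝓡 : CerSchema.{a, u} Att} {Val : Type d} {X : Type v}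
  {𝓑 : Set (FOPredicate (𝓡.Tuples Val))}

theorem finite_vdefPlus : ∀ φ : FOCEL 𝓡 Val X 𝓑, φ.vdefPlus.Finite
  | as _ x => Set.finite_singleton x
  | filter φ _ _ => finite_vdefPlus φ
  | or φ₁ φ₂ => (finite_vdefPlus φ₁).union (finite_vdefPlus φ₂)
  | seq φ₁ φ₂ => (finite_vdefPlus φ₁).union (finite_vdefPlus φ₂)
  | plus _ => Set.finite_empty

variable (X 𝓑) in
/-- A predicate applied to variables. -/
abbrev Atom := Σ P : 𝓑, Fin P.1.arity → X

/-- The atoms of the filters of a formula. -/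
def atoms : FOCEL 𝓡 Val X 𝓑 → List (Atom X 𝓑)
  | as _ _ => []
  | filter φ P x => ⟨P, x⟩ :: atoms φ
  | or φ₁ φ₂ => atoms φ₁ ++ atoms φ₂
  | seq φ₁ φ₂ => atoms φ₁ ++ atoms φ₂
  | plus φ => atoms φ

section Translation

variable {ι : Type u} [Fintype ι] (atm : ι → Atom X 𝓑) (dep : X → ℕ)

/-- The labels of the translation: next to the relation names, one label for each argument of each
atom. -/
noncomputable def atomLabels : LabelSet 𝓡 where
  Label := 𝓡.Rel ⊕ Σ a : ι, Fin (atm a).1.1.arity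
  fintype_label :=
    haveI := 𝓡.finite_rel
    Fintype.ofFinite _
  ofRel := Function.Embedding.inl

/-- The label of an argument of an atom. -/
def argLabel (a : ι) (m : Fin (atm a).1.1.arity) : (atomLabels atm).Label := .inr ⟨a, m⟩

/-- The universal extension of an atom as a predicate of the second-order logic. -/
def extPred (a : ι) : FOPredicate.extSet 𝓑 := ⟨(atm a).1.1.ext, (atm a).1.1, (atm a).1.2, rfl⟩

/-- The atom `a` holds for all events in the labels of its arguments. -/
def ExtHolds (S : 𝓡.Streams Val) (C : ComplexEvent (atomLabels atm)) (a : ι) : Prop :=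
  (fun m => C.events S (argLabel atm a m)) ∈ (atm a).1.1.ext.rel

/-- The second-order filters for a list of atoms. -/
def filterAtoms (ψ : SOCEL 𝓡 Val (atomLabels atm) (FOPredicate.extSet 𝓑)) :
    List ι → SOCEL 𝓡 Val (atomLabels atm) (FOPredicate.extSet 𝓑)
  | [] => ψ
  | a :: l => .filter (filterAtoms ψ l) (extPred atm a) (argLabel atm a)

/-- All variables of the atom are defined at depth `d` or deeper. -/
def LocalAt (d : ℕ) (a : ι) : Prop := ∀ m, d ≤ dep ((atm a).2 m)

/-- A choice of asserted atoms `A'` and defined variables `D'` for one evaluation of the body of an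
iteration at depth `d` is admissible if the non-local atoms of `A'` are asserted outside and all
variables of depth `d` of the atoms of `A'` are defined. -/
def Admissible (d : ℕ) (A A' : Finset ι) (D' : Finset X) : Prop :=
  (∀ a ∈ A', ¬ LocalAt atm dep d a → a ∈ A) ∧
    ∀ a ∈ A', ∀ m, dep ((atm a).2 m) = d → (atm a).2 m ∈ D'

open Classical in
/-- The labels of the arguments `x` of the atoms of `A`. -/
noncomputable def varLabels (A : Finset ι) (x : X) : List (atomLabels atm).Label :=
  ((Finset.univ.filter fun s : Σ a : ι, Fin (atm a).1.1.arity =>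
    s.1 ∈ A ∧ (atm s.1).2 s.2 = x).toList).map fun s => argLabel atm s.1 s.2

open Classical in
/-- The second-order formulas for the evaluations of `φ` at depth `d` that use atoms of `A` only and
define exactly the variables `D`. -/
noncomputable def translate : FOCEL 𝓡 Val X 𝓑 → ℕ → Finset ι → Finset X →
    List (SOCEL 𝓡 Val (atomLabels atm) (FOPredicate.extSet 𝓑))
  | as R x, _, A, D => if D = {x} then [.inLabels (.rel R) (varLabels atm A x)] else []
  -- The filter only requires its atom to be among the guessed ones; the second-order check is
  -- emitted at the end of a body, by `filterAtoms`.
  | filter φ P x, d, A, D => if ∃ a ∈ A, atm a = ⟨P, x⟩ then translate φ d A D else []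
  | or φ₁ φ₂, d, A, D => translate φ₁ d A D ++ translate φ₂ d A D
  -- The parts define complementary subsets of `D`: a variable has one value, which cannot lie on
  -- both sides of the cut.
  | seq φ₁ φ₂, d, A, D => D.powerset.toList.flatMap fun D₁ =>
      (translate φ₁ d A D₁).flatMap fun ψ₁ => (translate φ₂ d A (D \ D₁)).map fun ψ₂ => .seq ψ₁ ψ₂
  | plus φ, d, A, D => if D = ∅ then
      SOCEL.plusList ((Finset.univ.toList).flatMap fun A' : Finset ι =>
        (φ.finite_vdefPlus.toFinset.powerset.toList).flatMap fun D' =>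
          if Admissible atm dep (d + 1) A A' D' then
            (translate φ (d + 1) A' D').map fun ψ =>
              filterAtoms atm ψ (A'.filter (LocalAt atm dep (d + 1))).toList
          else [])
    else []

open Classical in
/-- The second-order formulas for one evaluation of the body `φ` of an iteration at depth `d`, when
the atoms `A` are asserted outside. -/
noncomputable def translateBody (φ : FOCEL 𝓡 Val X 𝓑) (d : ℕ) (A : Finset ι) :
    List (SOCEL 𝓡 Val (atomLabels atm) (FOPredicate.extSet 𝓑)) :=
  (Finset.univ.toList).flatMap fun A' : Finset ι =>
    (φ.finite_vdefPlus.toFinset.powerset.toList).flatMap fun D' =>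
      if Admissible atm dep d A A' D' then
        (translate atm dep φ d A' D').map fun ψ =>
          filterAtoms atm ψ (A'.filter (LocalAt atm dep d)).toList
      else []

/-- The complex events of the translation. -/
def TrSem (S : 𝓡.Streams Val) (φ : FOCEL 𝓡 Val X 𝓑) (d : ℕ) (A : Finset ι) (D : Finset X)
    (i j : ℕ) (C : ComplexEvent (atomLabels atm)) : Prop :=
  ∃ ψ ∈ translate atm dep φ d A D, SOCEL.Sem S ψ i j C

/-- The complex events of the translation of the body of an iteration. -/
def BodySem (S : 𝓡.Streams Val) (φ : FOCEL 𝓡 Val X 𝓑) (d : ℕ) (A : Finset ι)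
    (i j : ℕ) (C : ComplexEvent (atomLabels atm)) : Prop :=
  ∃ (A' : Finset ι) (D' : Finset X), ↑D' ⊆ φ.vdefPlus ∧ Admissible atm dep d A A' D' ∧
    TrSem atm dep S φ d A' D' i j C ∧ ∀ a ∈ A', LocalAt atm dep d a → ExtHolds atm S C a

variable {atm dep} {S : 𝓡.Streams Val} {i j dp : ℕ} {A : Finset ι} {D : Finset X}
  {C : ComplexEvent (atomLabels atm)} {φ φ₁ φ₂ : FOCEL 𝓡 Val X 𝓑}

theorem sem_filterAtoms_iff {ψ : SOCEL 𝓡 Val (atomLabels atm) (FOPredicate.extSet 𝓑)}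
    {l : List ι} :
    SOCEL.Sem S (filterAtoms atm ψ l) i j C ↔ SOCEL.Sem S ψ i j C ∧ ∀ a ∈ l, ExtHolds atm S C a := by
  induction l with
  | nil => simp [filterAtoms]
  | cons a l ih =>
    rw [List.forall_mem_cons, and_left_comm, ← ih, and_comm]
    exact SOCEL.sem_filter_iff

open Classical in
theorem mem_translateBody_iff {ψ : SOCEL 𝓡 Val (atomLabels atm) (FOPredicate.extSet 𝓑)} :
    ψ ∈ translateBody atm dep φ dp A ↔ ∃ (A' : Finset ι) (D' : Finset X), ↑D' ⊆ φ.vdefPlus ∧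
      Admissible atm dep dp A A' D' ∧ ∃ χ ∈ translate atm dep φ dp A' D',
        filterAtoms atm χ (A'.filter (LocalAt atm dep dp)).toList = ψ := by
  simp only [translateBody, List.mem_flatMap, Finset.mem_toList, Finset.mem_univ, true_and,
    Finset.mem_powerset, Set.Finite.subset_toFinset]
  refine exists_congr fun A' => exists_congr fun D' => and_congr_right fun _ => ?_
  split_ifs with hA
  · simp [hA]
  · simp [hA]

theorem translateBody_ne_nil {A' : Finset ι} (hD : ↑D ⊆ φ.vdefPlus)
    (hA : Admissible atm dep dp A A' D) (h : translate atm dep φ dp A' D ≠ []) :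
    translateBody atm dep φ dp A ≠ [] := by
  obtain ⟨ψ, hψ⟩ := List.exists_mem_of_ne_nil _ h
  exact List.ne_nil_of_mem (mem_translateBody_iff.2 ⟨A', D, hD, hA, ψ, hψ, rfl⟩)

theorem exists_sem_translateBody_iff :
    (∃ ψ ∈ translateBody atm dep φ dp A, SOCEL.Sem S ψ i j C) ↔
      BodySem atm dep S φ dp A i j C := by
  simp only [mem_translateBody_iff, BodySem, TrSem]
  constructor
  · rintro ⟨_, ⟨A', D', hD, hA, χ, hχ, rfl⟩, h⟩
    rw [sem_filterAtoms_iff] at h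
    exact ⟨A', D', hD, hA, ⟨χ, hχ, h.1⟩, fun a ha hl => h.2 a (by simp [ha, hl])⟩
  · rintro ⟨A', D', hD, hA, ⟨χ, hχ, h⟩, hl⟩
    refine ⟨_, ⟨A', D', hD, hA, χ, hχ, rfl⟩, sem_filterAtoms_iff.2 ⟨h, fun a ha => ?_⟩⟩
    simp only [Finset.mem_toList, Finset.mem_filter] at ha
    exact hl a ha.1 ha.2

/-! ### Inversion rules for the translation -/

open Classical in
theorem trSem_as_iff {R : 𝓡.Rel} {x : X} :
    TrSem atm dep S (as R x) dp A D i j C ↔ D = {x} ∧ i ≤ j ∧ (S j).1 = R ∧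
      C = fun B => if B = (atomLabels atm).ofRel R ∨ B ∈ varLabels atm A x then {j} else ∅ := by
  rw [TrSem, translate]
  split_ifs with h
  · simp only [List.mem_singleton, exists_eq_left, SOCEL.sem_inLabels_rel_iff, h, true_and]
  · simp [h]

theorem trSem_filter_iff {P : 𝓑} {x : Fin P.1.arity → X} :
    TrSem atm dep S (filter φ P x) dp A D i j C ↔
      (∃ a ∈ A, atm a = ⟨P, x⟩) ∧ TrSem atm dep S φ dp A D i j C := by
  rw [TrSem, translate]
  split_ifs with h
  · simp only [h, true_and, TrSem]
  · simp [h]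

theorem trSem_or_iff :
    TrSem atm dep S (or φ₁ φ₂) dp A D i j C ↔
      TrSem atm dep S φ₁ dp A D i j C ∨ TrSem atm dep S φ₂ dp A D i j C := by
  simp only [TrSem, translate, List.mem_append, or_and_right, exists_or]

open Classical in
theorem trSem_seq_iff :
    TrSem atm dep S (seq φ₁ φ₂) dp A D i j C ↔ ∃ D₁ ⊆ D, ∃ k C₁ C₂,
      TrSem atm dep S φ₁ dp A D₁ i k C₁ ∧ TrSem atm dep S φ₂ dp A (D \ D₁) (k + 1) j C₂ ∧
        C₁.Before C₂ ∧ C = C₁.concat C₂ := by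
  simp only [TrSem, translate, List.mem_flatMap, Finset.mem_toList, Finset.mem_powerset,
    List.mem_map]
  constructor
  · rintro ⟨ψ, ⟨D₁, hD, ψ₁, hψ₁, ψ₂, hψ₂, rfl⟩, h⟩
    obtain ⟨k, C₁, C₂, h₁, h₂, h₃, rfl⟩ := SOCEL.sem_seq_iff.1 h
    exact ⟨D₁, hD, k, C₁, C₂, ⟨ψ₁, hψ₁, h₁⟩, ⟨ψ₂, hψ₂, h₂⟩, h₃, rfl⟩
  · rintro ⟨D₁, hD, k, C₁, C₂, ⟨ψ₁, hψ₁, h₁⟩, ⟨ψ₂, hψ₂, h₂⟩, h₃, rfl⟩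
    exact ⟨_, ⟨D₁, hD, ψ₁, hψ₁, ψ₂, hψ₂, rfl⟩, .seq h₁ h₂ h₃⟩

/-- The iteration clause of `translate` is `translateBody` written out, to keep the recursion
structural. -/
theorem translate_plus :
    translate atm dep (plus φ) dp A ∅ = SOCEL.plusList (translateBody atm dep φ (dp + 1) A) := by
  rw [translate, if_pos rfl]
  rfl

theorem trSem_plus_iff :
    TrSem atm dep S (plus φ) dp A D i j C ↔ D = ∅ ∧ SeqClosure ComplexEvent.concat
      ComplexEvent.Before (BodySem atm dep S φ (dp + 1) A) i j C := by
  by_cases h : D = ∅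
  · subst h
    rw [TrSem, translate_plus, SOCEL.exists_sem_plusList_iff]
    simp only [exists_sem_translateBody_iff, true_and]
  · simp [TrSem, translate, h]

end Translation

end FOCEL

/-! ### Correctness of the translation -/

namespace FOCEL

variable {Att : Type a} {𝓡 : CerSchema.{a, u} Att} {Val : Type d} {X : Type v}
  {𝓑 : Set (FOPredicate (𝓡.Tuples Val))}

/-- The variables defined in the scope of `n` operators `+` have depth `d + n`, and every filter
uses variables of the current or a smaller depth. -/
def Leveled (dep : X → ℕ) : ℕ → FOCEL 𝓡 Val X 𝓑 → Prop
  | d, as _ x => dep x = d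
  | d, filter φ _ x => (∀ m, dep (x m) ≤ d) ∧ Leveled dep d φ
  | d, or φ₁ φ₂ => Leveled dep d φ₁ ∧ Leveled dep d φ₂
  | d, seq φ₁ φ₂ => Leveled dep d φ₁ ∧ Leveled dep d φ₂
  | d, plus φ => Leveled dep (d + 1) φ

theorem Leveled.dep_eq {dep : X → ℕ} {φ : FOCEL 𝓡 Val X 𝓑} {n : ℕ} (h : Leveled dep n φ) {x : X}
    (hx : x ∈ φ.vdefPlus) : dep x = n := by
  induction φ with
  | as R y => obtain rfl := hx; exact h
  | filter φ P y ih => exact ih h.2 hx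
  | or φ₁ φ₂ ih₁ ih₂ => exact hx.elim (ih₁ h.1) (ih₂ h.2)
  | seq φ₁ φ₂ ih₁ ih₂ => exact hx.elim (ih₁ h.1) (ih₂ h.2)
  | plus φ => exact hx.elim

theorem bound_subset_vdefPlus (φ : FOCEL 𝓡 Val X 𝓑) : φ.bound ⊆ φ.vdefPlus := by
  induction φ with
  | as R y => exact subset_rfl
  | filter φ P y ih => exact ih
  | or φ₁ φ₂ ih₁ ih₂ => exact fun x hx => .inl (ih₁ hx.1)
  | seq φ₁ φ₂ ih₁ ih₂ => exact Set.union_subset_union ih₁ ih₂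
  | plus φ => exact subset_rfl

theorem Sem.le {φ : FOCEL 𝓡 Val X 𝓑} {S : 𝓡.Streams Val} {i j : ℕ} {ν : X → ℕ} {M : Finset ℕ}
    (h : Sem S φ i j ν M) : i ≤ j := by
  induction h with
  | as h₁ h₂ => exact h₂ ▸ h₁
  | filter _ _ ih => exact ih
  | or_left _ ih => exact ih
  | or_right _ ih => exact ih
  | seq _ _ _ ih₁ ih₂ => omega
  | plus_one _ _ ih => exact ih
  | plus_step _ _ ih => exact ih

/-! ### Invariants linking labels and valuations -/

section Translation

variable {ι : Type u} [Fintype ι] (atm : ι → Atom X 𝓑) (dep : X → ℕ)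

/-- The atom `a` holds if the arguments of depth less than `n` are given by the valuation, for all
positions of the other arguments in their labels. -/
def HoldsBelow (S : 𝓡.Streams Val) (n : ℕ) (ν : X → ℕ) (C : ComplexEvent (atomLabels atm))
    (a : ι) : Prop :=
  ∀ p : Fin (atm a).1.1.arity → ℕ, (∀ m, dep ((atm a).2 m) < n → p m = ν ((atm a).2 m)) →
    (∀ m, n ≤ dep ((atm a).2 m) → p m ∈ C (argLabel atm a m)) →
      (fun m => S (p m)) ∈ (atm a).1.1.rel

/-- The labels of the arguments of depth at most `n` of the atoms of `A` are the values of the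
defined variables. -/
def Labeled (n : ℕ) (A : Finset ι) (D : Finset X) (ν : X → ℕ)
    (C : ComplexEvent (atomLabels atm)) : Prop :=
  ∀ a m p, dep ((atm a).2 m) ≤ n →
    (p ∈ C (argLabel atm a m) ↔ a ∈ A ∧ (atm a).2 m ∈ D ∧ p = ν ((atm a).2 m))

variable {atm dep} {S : 𝓡.Streams Val} {i j n : ℕ} {A : Finset ι} {D : Finset X} {ν : X → ℕ}
  {C C₁ C₂ : ComplexEvent (atomLabels atm)} {φ φ₁ φ₂ : FOCEL 𝓡 Val X 𝓑} {a : ι}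

theorem argLabel_mem_varLabels_iff {m : Fin (atm a).1.1.arity} {x : X} :
    argLabel atm a m ∈ varLabels atm A x ↔ a ∈ A ∧ (atm a).2 m = x := by
  simp only [varLabels, List.mem_map, Finset.mem_toList, Finset.mem_filter, Finset.mem_univ, true_and]
  constructor
  · rintro ⟨s, hs, h⟩
    obtain rfl : s = ⟨a, m⟩ := Sum.inr_injective h
    exact hs
  · exact fun h => ⟨⟨a, m⟩, h, rfl⟩

open Classical in
/-- The complex event of the translation of `R AS x` at position `j`. -/
noncomputable def asEvent (atm : ι → Atom X 𝓑) (R : 𝓡.Rel) (A : Finset ι) (x : X) (j : ℕ) :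
    ComplexEvent (atomLabels atm) :=
  fun B => if B = (atomLabels atm).ofRel R ∨ B ∈ varLabels atm A x then {j} else ∅

theorem supp_asEvent {R : 𝓡.Rel} {x : X} : (asEvent atm R A x j).supp = {j} := by
  ext p
  rw [ComplexEvent.mem_supp, Finset.mem_singleton]
  constructor
  · rintro ⟨B, hB⟩
    by_cases h : B = (atomLabels atm).ofRel R ∨ B ∈ varLabels atm A x
    · rwa [asEvent, if_pos h, Finset.mem_singleton] at hB
    · rw [asEvent, if_neg h] at hB
      simp at hB
  · rintro rfl
    refine ⟨(atomLabels atm).ofRel R, ?_⟩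
    rw [asEvent, if_pos (.inl rfl), Finset.mem_singleton]

theorem mem_asEvent_iff {R : 𝓡.Rel} {x : X} {m : Fin (atm a).1.1.arity} {p : ℕ} :
    p ∈ asEvent atm R A x j (argLabel atm a m) ↔ a ∈ A ∧ (atm a).2 m = x ∧ p = j := by
  rw [← and_assoc, ← argLabel_mem_varLabels_iff, asEvent]
  by_cases h : argLabel atm a m ∈ varLabels atm A x
  · rw [if_pos (.inr h), Finset.mem_singleton, and_iff_right h]
  · rw [if_neg (by rintro (h' | h'); exacts [Sum.inr_ne_inl h', h h'])]
    simp [h]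

theorem labeled_asEvent {R : 𝓡.Rel} {x : X} :
    Labeled atm dep n A {x} ν (asEvent atm R A x (ν x)) := by
  intro a m p _
  rw [mem_asEvent_iff, Finset.mem_singleton]
  refine and_congr_right fun _ => and_congr_right fun h => ?_
  rw [h]

theorem Labeled.concat {D₁ D₂ : Finset X} (hD : ∀ x, x ∈ D ↔ x ∈ D₁ ∨ x ∈ D₂)
    (h₁ : Labeled atm dep n A D₁ ν C₁)
    (h₂ : Labeled atm dep n A D₂ ν C₂) : Labeled atm dep n A D ν (C₁.concat C₂) := by
  intro a m p hm
  rw [ComplexEvent.concat, Finset.mem_union, h₁ a m p hm, h₂ a m p hm, hD]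
  tauto

/-- Labels are ranges of a universal quantifier, so the condition is antitone in the complex event.
This hands an assertion down to the parts of a concatenation. -/
theorem HoldsBelow.mono (h : HoldsBelow atm dep S n ν C a) (hC : ∀ B, C₁ B ⊆ C B) :
    HoldsBelow atm dep S n ν C₁ a :=
  fun p h₁ h₂ => h p h₁ fun m hm => hC _ (h₂ m hm)

theorem HoldsBelow.concat_left (h : HoldsBelow atm dep S n ν (C₁.concat C₂) a) :
    HoldsBelow atm dep S n ν C₁ a := h.mono fun _ => Finset.subset_union_left

theorem HoldsBelow.concat_right (h : HoldsBelow atm dep S n ν (C₁.concat C₂) a) :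
    HoldsBelow atm dep S n ν C₂ a := h.mono fun _ => Finset.subset_union_right

/-- An atom of arity at most two with an argument given by the valuation has at most one labelled
argument, so that it holds for a concatenation if it holds for both parts. -/
theorem HoldsBelow.concat (ha : (atm a).1.1.arity ≤ 2) (hm : ∃ m, dep ((atm a).2 m) < n)
    (h₁ : HoldsBelow atm dep S n ν C₁ a) (h₂ : HoldsBelow atm dep S n ν C₂ a) :
    HoldsBelow atm dep S n ν (C₁.concat C₂) a := by
  obtain ⟨m₀, hm₀⟩ := hm
  intro p hp hC
  by_cases hm₁ : ∃ m, n ≤ dep ((atm a).2 m)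
  · obtain ⟨m₁, hm₁⟩ := hm₁
    -- One of at most two arguments is `m₀`, which is given by the valuation, so only one can be
    -- read from a label.
    have huniq : ∀ m, n ≤ dep ((atm a).2 m) → m = m₁ := by
      intro m hm
      have h₀ : m ≠ m₀ := by rintro rfl; omega
      have h₁ : m₁ ≠ m₀ := by rintro rfl; omega
      rw [Ne, Fin.ext_iff] at h₀ h₁
      have := m.2
      have := m₁.2
      have := m₀.2
      exact Fin.ext (by omega)
    rcases Finset.mem_union.1 (hC m₁ hm₁) with h | h
    · exact h₁ p hp fun m hm => huniq m hm ▸ h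
    · exact h₂ p hp fun m hm => huniq m hm ▸ h
  · push Not at hm₁
    exact h₁ p hp fun m hm => absurd (hm₁ m) (by omega)

/-- For a local atom no argument comes from the valuation, and the condition is the universal
extension itself. -/
theorem HoldsBelow.extHolds (h : HoldsBelow atm dep S n ν C a) (hl : LocalAt atm dep n a) :
    ExtHolds atm S C a := by
  intro t ht
  choose p hp ht using ht
  obtain rfl : t = fun m => S (p m) := funext fun m => (ht m).symm
  exact h p (fun m hm => absurd (hl m) (by omega)) fun m _ => hp m

theorem ExtHolds.holdsBelow (h : ExtHolds atm S C a) (hl : LocalAt atm dep n a) :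
    HoldsBelow atm dep S n ν C a :=
  fun p _ hp => h _ fun m => ⟨p m, hp m (hl m), rfl⟩

/-! #### Soundness -/

/-- A complex event of the translation fixes the defined variables, and its support is a match for
these if the asserted atoms hold. -/
def SoundAt (S : 𝓡.Streams Val) (φ : FOCEL 𝓡 Val X 𝓑) (n : ℕ) (A : Finset ι) (D : Finset X)
    (i j : ℕ) (C : ComplexEvent (atomLabels atm)) (dep : X → ℕ) : Prop :=
  ↑D ⊆ φ.vdefPlus ∧ ∃ ν₀ : X → ℕ, ∀ ν, (∀ x ∈ D, ν x = ν₀ x) → Labeled atm dep n A D ν C ∧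
    ((∀ a ∈ A, HoldsBelow atm dep S (n + 1) ν C a) → Sem S φ i j ν C.supp)

/-- An atom guessed in the body is either local and checked by its own filter, or asserted outside.
Either way it holds at level `n`, and admissibility turns this into level `n + 1` for the values
defined in the body. -/
theorem BodySem.sound
    (ih : ∀ {A D i j C}, TrSem atm dep S φ n A D i j C → SoundAt S φ n A D i j C dep)
    (hL : φ.Leveled dep n) (h : BodySem atm dep S φ n A i j C) :
    (∀ a m p, dep ((atm a).2 m) < n → p ∉ C (argLabel atm a m)) ∧
      ∀ ν, (∀ a ∈ A, HoldsBelow atm dep S n ν C a) →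
        ∃ ν', Sem S φ i j (override ν ν' φ.vdefPlus) C.supp := by
  obtain ⟨A', D', hD, ⟨hA, hA'⟩, hC, hE⟩ := h
  obtain ⟨-, ν₀, hν₀⟩ := ih hC
  constructor
  · intro a m p hm hp
    have := (((hν₀ ν₀ fun _ _ => rfl).1 a m p hm.le).1 hp).2.1
    have := hL.dep_eq (hD this)
    omega
  · intro ν hν
    obtain ⟨hlab, hsem⟩ := hν₀ (override ν ν₀ φ.vdefPlus) fun x hx => override_of_mem (hD hx)
    refine ⟨ν₀, hsem fun a ha p hp hpC => ?_⟩
    -- An argument of depth exactly `n` is now given by the valuation. Admissibility makes its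
    -- variable defined, so its value does lie in the label.
    have hpC' : ∀ m, n ≤ dep ((atm a).2 m) → p m ∈ C (argLabel atm a m) := by
      intro m hm
      rcases hm.eq_or_lt with h | h
      · exact (hlab a m _ h.ge).2 ⟨ha, hA' a ha m h.symm, hp m (by omega)⟩
      · exact hpC m h
    have hB : HoldsBelow atm dep S n ν C a := by
      by_cases hl : LocalAt atm dep n a
      · exact (hE a ha hl).holdsBelow hl
      · exact hν a (hA a ha hl)
    refine hB p (fun m hm => ?_) hpC'
    rw [hp m (by omega), override_of_notMem fun h => by have := hL.dep_eq h; omega]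

/-- The universal condition implies every comparison made in an evaluation, so no arity bound is
needed in this direction. -/
theorem TrSem.sound (hL : φ.Leveled dep n) (h : TrSem atm dep S φ n A D i j C) :
    SoundAt S φ n A D i j C dep := by
  classical
  induction φ generalizing n A D i j C with
  | as R x =>
    obtain ⟨rfl, h₁, h₂, rfl⟩ := trSem_as_iff.1 h
    refine ⟨by simp [vdefPlus], fun _ => j, fun ν hν => ?_⟩
    obtain rfl := hν x (by simp)
    refine ⟨labeled_asEvent, fun _ => sem_as_iff.2 ⟨h₁, rfl, h₂, supp_asEvent⟩⟩
  | filter φ P x ih =>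
    obtain ⟨⟨a, ha, hax⟩, h⟩ := trSem_filter_iff.1 h
    obtain ⟨hD, ν₀, hν₀⟩ := ih hL.2 h
    refine ⟨hD, ν₀, fun ν hν => ⟨(hν₀ ν hν).1, fun hA =>
      sem_filter_iff.2 ⟨(hν₀ ν hν).2 hA, ?_⟩⟩⟩
    -- All arguments of a filter at depth `n` come from the valuation, so the assertion reduces to
    -- the predicate at `ν`.
    have hdep : ∀ m, dep ((atm a).2 m) < n + 1 := by
      rw [hax]
      exact fun m => Nat.lt_succ_of_le (hL.1 m)
    have := hA a ha (fun m => ν ((atm a).2 m)) (fun _ _ => rfl)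
      fun m hm => absurd (hdep m) (by omega)
    rwa [hax] at this
  | or φ₁ φ₂ ih₁ ih₂ =>
    rcases trSem_or_iff.1 h with h | h
    · obtain ⟨hD, ν₀, hν₀⟩ := ih₁ hL.1 h
      exact ⟨fun x hx => .inl (hD hx), ν₀,
        fun ν hν => ⟨(hν₀ ν hν).1, fun hA => .or_left ((hν₀ ν hν).2 hA)⟩⟩
    · obtain ⟨hD, ν₀, hν₀⟩ := ih₂ hL.2 h
      exact ⟨fun x hx => .inr (hD hx), ν₀,
        fun ν hν => ⟨(hν₀ ν hν).1, fun hA => .or_right ((hν₀ ν hν).2 hA)⟩⟩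
  | seq φ₁ φ₂ ih₁ ih₂ =>
    obtain ⟨D₁, hD, k, C₁, C₂, h₁, h₂, h₃, rfl⟩ := trSem_seq_iff.1 h
    obtain ⟨hD₁, ν₁, hν₁⟩ := ih₁ hL.1 h₁
    obtain ⟨hD₂, ν₂, hν₂⟩ := ih₂ hL.2 h₂
    refine ⟨fun x hx => ?_, fun x => if x ∈ D₁ then ν₁ x else ν₂ x, fun ν hν => ?_⟩
    · by_cases hx₁ : x ∈ D₁
      · exact .inl (hD₁ hx₁)
      · exact .inr (hD₂ (by simpa using ⟨hx, hx₁⟩))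
    · obtain ⟨hl₁, hs₁⟩ := hν₁ ν fun x hx => (hν x (hD hx)).trans (if_pos hx)
      obtain ⟨hl₂, hs₂⟩ := hν₂ ν fun x hx => by
        rw [Finset.mem_sdiff] at hx
        exact (hν x hx.1).trans (if_neg hx.2)
      refine ⟨hl₁.concat (fun x => ?_) hl₂, fun hA => ?_⟩
      · rw [Finset.mem_sdiff]
        have := @hD x
        tauto
      · rw [ComplexEvent.supp_concat]
        exact .seq (hs₁ fun a ha => (hA a ha).concat_left)
          (hs₂ fun a ha => (hA a ha).concat_right) h₃
  | plus φ ih =>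
    obtain ⟨rfl, hc⟩ := trSem_plus_iff.1 h
    suffices H : (∀ a m p, dep ((atm a).2 m) < n + 1 → p ∉ C (argLabel atm a m)) ∧
        ∀ ν, (∀ a ∈ A, HoldsBelow atm dep S (n + 1) ν C a) →
          SeqClosure (· ∪ ·) MatchBefore
            (fun i j M => ∃ ν', Sem S φ i j (override ν ν' φ.vdefPlus) M) i j C.supp by
      -- With `D` empty, `ν₀` is irrelevant; labels of arguments of depth at most `n` are empty,
      -- since the body defines only deeper variables.
      refine ⟨by simp, fun _ => 0, fun ν _ => ⟨fun a m p hm => ?_, fun hA =>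
        sem_plus_iff.2 (H.2 ν hA)⟩⟩
      simp [H.1 a m p (by omega)]
    clear * - hc ih hL
    have hb {i j C} (h : BodySem atm dep S φ (n + 1) A i j C) := h.sound (ih hL) hL
    induction hc with
    | one h => exact ⟨(hb h).1, fun ν hν => .one ((hb h).2 ν hν)⟩
    | step h₁ _ h₃ ih₂ =>
      refine ⟨fun a m p hm hp => ?_, fun ν hν => ?_⟩
      · exact (Finset.mem_union.1 hp).elim ((hb h₁).1 a m p hm) (ih₂.1 a m p hm)
      · rw [ComplexEvent.supp_concat]
        exact .step ((hb h₁).2 ν fun a ha => (hν a ha).concat_left)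
          (ih₂.2 ν fun a ha => (hν a ha).concat_right) h₃

/-! #### Completeness -/

variable (atm dep) in
/-- The match `M` is the support of a complex event of the translation at depth `n`, whenever some
set of atoms, all satisfied, is asserted. -/
def CompleteAt (S : 𝓡.Streams Val) (φ : FOCEL 𝓡 Val X 𝓑) (n : ℕ) (V : Set X) (i j : ℕ)
    (ν : X → ℕ) (M : Finset ℕ) : Prop :=
  ∃ (A₀ : Finset ι) (D : Finset X), ↑D ⊆ φ.vdefPlus ∧ φ.bound ⊆ ↑D ∧
    (∀ x ∈ D, i ≤ ν x ∧ ν x ≤ j) ∧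
    (∀ a ∈ A₀, (∃ m, dep ((atm a).2 m) ≤ n) ∨ ∀ m, dep ((atm a).2 m) ≤ n) ∧
    (∀ a ∈ A₀, ∀ m, dep ((atm a).2 m) ≤ n → (atm a).2 m ∈ V ∪ ↑D) ∧
    (∀ a ∈ A₀, (∀ m, dep ((atm a).2 m) ≤ n) →
      (fun m => S (ν ((atm a).2 m))) ∈ (atm a).1.1.rel) ∧
    ∀ A, A₀ ⊆ A → ∃ C, TrSem atm dep S φ n A D i j C ∧ C.supp = M ∧ Labeled atm dep n A D ν C ∧
      ∀ a, (∃ m, dep ((atm a).2 m) ≤ n) → (∃ m, n < dep ((atm a).2 m)) →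
        HoldsBelow atm dep S (n + 1) ν C a

variable (atm dep) in
/-- The match `M` is the support of a complex event of `Q`, whenever some set of non-local atoms,
all satisfied, is asserted. -/
def BodyComplete (S : 𝓡.Streams Val) (n : ℕ) (V : Set X) (ν : X → ℕ) (M : Finset ℕ)
    (Q : Finset ι → ComplexEvent (atomLabels atm) → Prop) : Prop :=
  ∃ A₀ : Finset ι, (∀ a ∈ A₀, ¬ LocalAt atm dep n a) ∧
    (∀ a ∈ A₀, ∀ m, dep ((atm a).2 m) < n → (atm a).2 m ∈ V) ∧
    (∀ a ∈ A₀, (∀ m, dep ((atm a).2 m) < n) →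
      (fun m => S (ν ((atm a).2 m))) ∈ (atm a).1.1.rel) ∧
    ∀ A, A₀ ⊆ A → ∃ C, Q A C ∧ C.supp = M ∧
      (∀ a m p, dep ((atm a).2 m) < n → p ∉ C (argLabel atm a m)) ∧
      ∀ a, (∃ m, dep ((atm a).2 m) < n) → (∃ m, n ≤ dep ((atm a).2 m)) →
        HoldsBelow atm dep S n ν C a

variable {V : Set X} {M : Finset ℕ}

/-- The body guesses exactly the atoms it uses; the local ones are discharged here and the others
are passed outwards. -/
theorem CompleteAt.body {ν' : X → ℕ} (hL : φ.Leveled dep n) (hV : ∀ x ∈ V, dep x < n)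
    (h : CompleteAt atm dep S φ n V i j (override ν ν' φ.vdefPlus) M) :
    BodyComplete atm dep S n V ν M (BodySem atm dep S φ n · i j) := by
  classical
  obtain ⟨A', D, hD, -, -, hmix, hVD, hP, hC⟩ := h
  set η := override ν ν' φ.vdefPlus with hη
  have hηlt : ∀ x, dep x < n → η x = ν x := fun x hx =>
    override_of_notMem fun h => by have := hL.dep_eq h; omega
  refine ⟨A'.filter fun a => ¬ LocalAt atm dep n a, by simp, fun a ha m hm => ?_,
    fun a ha hm => ?_, fun A hA => ?_⟩
  · refine (hVD a (Finset.mem_filter.1 ha).1 m hm.le).resolve_right fun h => ?_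
    have := hL.dep_eq (hD h)
    omega
  · have := hP a (Finset.mem_filter.1 ha).1 fun m => (hm m).le
    simpa only [hηlt _ (hm _)] using this
  · obtain ⟨C, hT, hsupp, hlab, hH⟩ := hC A' subset_rfl
    have hH' : ∀ a ∈ A', HoldsBelow atm dep S (n + 1) η C a := by
      intro a ha
      by_cases hm : ∃ m, n < dep ((atm a).2 m)
      · refine hH a ((hmix a ha).elim id fun h => ?_) hm
        obtain ⟨m, hm⟩ := hm
        exact ⟨m, h m⟩
      · push Not at hm
        intro p hp _
        obtain rfl : p = fun m => η ((atm a).2 m) :=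
          funext fun m => hp m (Nat.lt_succ_of_le (hm m))
        exact hP a ha hm
    -- By `Labeled`, the label of an argument of depth `n` contains at most its value under `η`, so
    -- quantifying over the label is no stronger than using that value.
    have hlower : ∀ a, HoldsBelow atm dep S (n + 1) η C a → HoldsBelow atm dep S n ν C a := by
      intro a ha p hp hpC
      refine ha p (fun m hm => ?_) fun m hm => hpC m (by omega)
      rcases (Nat.lt_succ_iff.1 hm).eq_or_lt with h | h
      · exact ((hlab a m _ h.le).1 (hpC m h.ge)).2.2
      · rw [hp m h, hηlt _ h]
    refine ⟨C, ⟨A', D, hD, ⟨fun a ha hl => hA (by simp [ha, hl]), fun a ha m hm => ?_⟩, hT,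
      fun a ha hl => (hlower a (hH' a ha)).extHolds hl⟩, hsupp, fun a m p hm hp => ?_,
      fun a hm₀ hm₁ => ?_⟩
    · refine (hVD a ha m hm.le).resolve_left fun h => ?_
      have := hV _ h
      omega
    · have := hL.dep_eq (hD ((hlab a m p hm.le).1 hp).2.1)
      omega
    · by_cases ha : a ∈ A'
      · exact hlower a (hH' a ha)
      · obtain ⟨m₀, hm₀⟩ := hm₀
        obtain ⟨m₁, hm₁⟩ := hm₁
        rcases hm₁.eq_or_lt with h | h
        -- An atom that is not guessed has empty labels at depth `n`, so the condition is vacuous.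
        · exact fun p _ hpC => absurd ((hlab a m₁ _ h.ge).1 (hpC m₁ hm₁)).1 ha
        · exact hlower a (hH a ⟨m₀, hm₀.le⟩ ⟨m₁, h⟩)

/-- Iterations may need different outer atoms, so their union is asserted; being complete for all
larger sets lets each iteration accept it. The arity bound prevents comparisons across iterations.
-/
theorem BodyComplete.closure (h2 : ∀ a, (atm a).1.1.arity ≤ 2)
    {Q : ℕ → ℕ → Finset ℕ → Prop}
    {Q' : Finset ι → ℕ → ℕ → ComplexEvent (atomLabels atm) → Prop}
    (hQ : ∀ i j M, Q i j M → BodyComplete atm dep S n V ν M (Q' · i j))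
    (h : SeqClosure (· ∪ ·) MatchBefore Q i j M) :
    BodyComplete atm dep S n V ν M
      fun A C => SeqClosure ComplexEvent.concat ComplexEvent.Before (Q' A) i j C := by
  classical
  induction h with
  | one h =>
    obtain ⟨A₀, h₁, h₂, h₃, h₄⟩ := hQ _ _ _ h
    refine ⟨A₀, h₁, h₂, h₃, fun A hA => ?_⟩
    obtain ⟨C, hC, h⟩ := h₄ A hA
    exact ⟨C, .one hC, h⟩
  | step h _ hb ih =>
    obtain ⟨A₁, h₁, h₂, h₃, h₄⟩ := hQ _ _ _ h
    obtain ⟨A₂, h₁', h₂', h₃', h₄'⟩ := ih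
    refine ⟨A₁ ∪ A₂, fun a ha => (Finset.mem_union.1 ha).elim (h₁ a) (h₁' a),
      fun a ha => (Finset.mem_union.1 ha).elim (h₂ a) (h₂' a),
      fun a ha => (Finset.mem_union.1 ha).elim (h₃ a) (h₃' a), fun A hA => ?_⟩
    obtain ⟨C₁, hC₁, rfl, he₁, hH₁⟩ := h₄ A (Finset.union_subset_left hA)
    obtain ⟨C₂, hC₂, rfl, he₂, hH₂⟩ := h₄' A (Finset.union_subset_right hA)
    refine ⟨C₁.concat C₂, .step hC₁ hC₂ hb, ComplexEvent.supp_concat _ _, fun a m p hm hp => ?_,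
      fun a hm₀ hm₁ => (hH₁ a hm₀ hm₁).concat (h2 a) hm₀ (hH₂ a hm₀ hm₁)⟩
    exact (Finset.mem_union.1 hp).elim (he₁ a m p hm) (he₂ a m p hm)

/-- The atoms and variables are read off the evaluation. Well-formedness puts each shallow argument
into `V` or `D`, which becomes admissibility at the end of the body. -/
theorem Sem.completeAt (h2 : ∀ a, (atm a).1.1.arity ≤ 2) (hcov : ∀ α ∈ φ.atoms, ∃ a, atm a = α)
    (hL : φ.Leveled dep n) (hwf : φ.WellFormedIn V) (hV : ∀ x ∈ V, dep x ≤ n)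
    (h : Sem S φ i j ν M) : CompleteAt atm dep S φ n V i j ν M := by
  classical
  induction φ generalizing n V i j ν M with
  | as R x =>
    obtain ⟨h₁, rfl, h₂, rfl⟩ := sem_as_iff.1 h
    refine ⟨∅, {x}, by simp [vdefPlus], by simp [bound], by simpa using h₁, by simp, by simp,
      by simp, fun A _ => ⟨asEvent atm R A x (ν x), trSem_as_iff.2 ⟨rfl, h₁, h₂, rfl⟩,
      supp_asEvent, labeled_asEvent, ?_⟩⟩
    -- The only labelled arguments are `x` itself, of depth `n`, so deeper arguments have empty
    -- labels.
    rintro a - ⟨m, hm⟩ p - hp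
    have h₁ := (mem_asEvent_iff.1 (hp m hm)).2.1
    have h₂ : dep x = n := hL
    rw [h₁, h₂] at hm
    exact absurd hm (lt_irrefl _)
  | filter φ P x ih =>
    obtain ⟨h, hp⟩ := sem_filter_iff.1 h
    obtain ⟨hw, hwf⟩ := hwf
    obtain ⟨A₀, D, hD, hb, hν, hmix, hVD, hP, hC⟩ := ih
      (fun α hα => hcov α (List.mem_cons_of_mem _ hα)) hL.2 hwf
      (fun x hx => hx.elim (hV x) fun h => (hL.2.dep_eq (φ.bound_subset_vdefPlus h)).le) h
    obtain ⟨a, ha⟩ := hcov ⟨P, x⟩ (by simp [atoms])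
    refine ⟨insert a A₀, D, hD, hb, hν, ?_, ?_, ?_, fun A hA => ?_⟩
    · refine Finset.forall_mem_insert _ _ _ |>.2 ⟨.inr ?_, hmix⟩
      rw [ha]
      exact hL.1
    · refine Finset.forall_mem_insert _ _ _ |>.2 ⟨?_, fun b hb' m hm => ?_⟩
      · rw [ha]
        exact fun m _ => (hw m).imp id fun h => hb h
      · rcases hVD b hb' m hm with (h | h) | h
        exacts [.inl h, .inr (hb h), .inr h]
    · refine Finset.forall_mem_insert _ _ _ |>.2 ⟨?_, hP⟩
      rw [ha]
      exact fun _ => hp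
    · obtain ⟨C, hT, h⟩ := hC A ((Finset.subset_insert _ _).trans hA)
      exact ⟨C, trSem_filter_iff.2 ⟨⟨a, hA (Finset.mem_insert_self _ _), ha⟩, hT⟩, h⟩
  | or φ₁ φ₂ ih₁ ih₂ =>
    have hV' : ∀ x ∈ V ∪ φ₁.bound ∩ φ₂.bound, dep x ≤ n := fun x hx => hx.elim (hV x)
      fun h => (hL.1.dep_eq (φ₁.bound_subset_vdefPlus h.1)).le
    rcases sem_or_iff.1 h with h | h
    · obtain ⟨A₀, D, hD, hb, hν, hmix, hVD, hP, hC⟩ := ih₁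
        (fun α hα => hcov α (List.mem_append_left _ hα)) hL.1 hwf.1 hV' h
      refine ⟨A₀, D, fun x hx => .inl (hD hx), fun x hx => hb hx.1, hν, hmix,
        fun a ha m hm => ?_, hP, fun A hA => ?_⟩
      · rcases hVD a ha m hm with (h | h) | h
        exacts [.inl h, .inr (hb h.1), .inr h]
      · obtain ⟨C, hT, h⟩ := hC A hA
        exact ⟨C, trSem_or_iff.2 (.inl hT), h⟩
    · obtain ⟨A₀, D, hD, hb, hν, hmix, hVD, hP, hC⟩ := ih₂
        (fun α hα => hcov α (List.mem_append_right _ hα)) hL.2 hwf.2 hV' h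
      refine ⟨A₀, D, fun x hx => .inr (hD hx), fun x hx => hb hx.2, hν, hmix,
        fun a ha m hm => ?_, hP, fun A hA => ?_⟩
      · rcases hVD a ha m hm with (h | h) | h
        exacts [.inl h, .inr (hb h.2), .inr h]
      · obtain ⟨C, hT, h⟩ := hC A hA
        exact ⟨C, trSem_or_iff.2 (.inr hT), h⟩
  | seq φ₁ φ₂ ih₁ ih₂ =>
    have hV' : ∀ x ∈ V ∪ (φ₁.bound ∪ φ₂.bound), dep x ≤ n := fun x hx => hx.elim (hV x)
      fun h => h.elim (fun h => (hL.1.dep_eq (φ₁.bound_subset_vdefPlus h)).le)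
        fun h => (hL.2.dep_eq (φ₂.bound_subset_vdefPlus h)).le
    obtain ⟨k, M₁, M₂, h₁, h₂, h₃, rfl⟩ := sem_seq_iff.1 h
    obtain ⟨A₁, D₁, hD₁, hb₁, hν₁, hmix₁, hVD₁, hP₁, hC₁⟩ := ih₁
      (fun α hα => hcov α (List.mem_append_left _ hα)) hL.1 hwf.1 hV' h₁
    obtain ⟨A₂, D₂, hD₂, hb₂, hν₂, hmix₂, hVD₂, hP₂, hC₂⟩ := ih₂
      (fun α hα => hcov α (List.mem_append_right _ hα)) hL.2 hwf.2 hV' h₂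
    -- A variable defined in both parts would have a value at most `k` and at least `k + 1`.
    have hdisj : Disjoint D₁ D₂ := Finset.disjoint_left.2 fun x hx₁ hx₂ => by
      have := (hν₁ x hx₁).2
      have := (hν₂ x hx₂).1
      omega
    have hik : i ≤ k + 1 ∧ k ≤ j := by
      have := h₁.le
      have := h₂.le
      omega
    refine ⟨A₁ ∪ A₂, D₁ ∪ D₂, ?_, ?_, fun x hx => ?_,
      fun a ha => (Finset.mem_union.1 ha).elim (hmix₁ a) (hmix₂ a), fun a ha m hm => ?_,
      fun a ha => (Finset.mem_union.1 ha).elim (hP₁ a) (hP₂ a), fun A hA => ?_⟩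
    · rw [Finset.coe_union]
      exact Set.union_subset_union hD₁ hD₂
    · rw [Finset.coe_union]
      exact Set.union_subset_union hb₁ hb₂
    · rcases Finset.mem_union.1 hx with hx | hx
      · exact ⟨(hν₁ x hx).1, (hν₁ x hx).2.trans hik.2⟩
      · have := hν₂ x hx
        omega
    · rw [Finset.coe_union]
      rcases Finset.mem_union.1 ha with ha | ha
      · rcases hVD₁ a ha m hm with (h | h | h) | h
        exacts [.inl h, .inr (.inl (hb₁ h)), .inr (.inr (hb₂ h)), .inr (.inl h)]
      · rcases hVD₂ a ha m hm with (h | h | h) | h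
        exacts [.inl h, .inr (.inl (hb₁ h)), .inr (.inr (hb₂ h)), .inr (.inr h)]
    · obtain ⟨C₁, hT₁, rfl, hl₁, hH₁⟩ := hC₁ A (Finset.union_subset_left hA)
      obtain ⟨C₂, hT₂, rfl, hl₂, hH₂⟩ := hC₂ A (Finset.union_subset_right hA)
      refine ⟨C₁.concat C₂, trSem_seq_iff.2 ⟨D₁, Finset.subset_union_left, k, C₁, C₂, hT₁, ?_, h₃,
        rfl⟩, ComplexEvent.supp_concat _ _, hl₁.concat (fun x => Finset.mem_union) hl₂,
        fun a hm₀ hm₁ => (hH₁ a hm₀ hm₁).concat (h2 a) ?_ (hH₂ a hm₀ hm₁)⟩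
      · rwa [Finset.union_sdiff_cancel_left hdisj]
      · exact hm₀.imp fun m hm => Nat.lt_succ_of_le hm
  | plus φ ih =>
    have hbody : BodyComplete atm dep S (n + 1) (V \ φ.vdefPlus) ν M fun A C => SeqClosure
        ComplexEvent.concat ComplexEvent.Before (BodySem atm dep S φ (n + 1) A) i j C := by
      refine BodyComplete.closure h2 (fun i j M h => ?_) (sem_plus_iff.1 h)
      obtain ⟨ν', h⟩ := h
      exact (ih hcov hL hwf (fun x hx => (hV x hx.1).trans n.le_succ) h).body hL
        fun x hx => Nat.lt_succ_of_le (hV x hx.1)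
    obtain ⟨A₀, hloc, hAV, hP, hC⟩ := hbody
    refine ⟨A₀, ∅, by simp, by simp [bound], by simp, fun a ha => .inl ?_, fun a ha m hm => ?_,
      fun a ha hm => hP a ha fun m => Nat.lt_succ_of_le (hm m), fun A hA => ?_⟩
    · have := hloc a ha
      simp only [LocalAt, not_forall, not_le] at this
      exact this.imp fun m hm => Nat.le_of_lt_succ hm
    · exact .inl (hAV a ha m (Nat.lt_succ_of_le hm)).1
    · obtain ⟨C, hT, hs, he, hH⟩ := hC A hA
      refine ⟨C, trSem_plus_iff.2 ⟨rfl, hT⟩, hs, fun a m p hm => ?_, fun a hm₀ hm₁ =>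
        hH a (hm₀.imp fun m hm => Nat.lt_succ_of_le hm) hm₁⟩
      simp [he a m p (Nat.lt_succ_of_le hm)]

/-! #### The translation of safe formulas -/

/-- This is the syntactic shadow of `Sem.completeAt`: no evaluation is at hand, and safety replaces
the position argument for the disjointness of `D₁` and `D₂`. -/
theorem Safe.exists_translate_ne_nil (hcov : ∀ α ∈ φ.atoms, ∃ a, atm a = α)
    (hL : φ.Leveled dep n) (hwf : φ.WellFormedIn V) (hV : ∀ x ∈ V, dep x ≤ n) (h : φ.Safe) :
    ∃ (A₀ : Finset ι) (D : Finset X), ↑D ⊆ φ.vdefPlus ∧ φ.bound ⊆ ↑D ∧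
      (∀ a ∈ A₀, ∀ m, dep ((atm a).2 m) ≤ n → (atm a).2 m ∈ V ∪ ↑D) ∧
      ∀ A, A₀ ⊆ A → translate atm dep φ n A D ≠ [] := by
  classical
  induction φ generalizing n V with
  | as R x =>
    exact ⟨∅, {x}, by simp [vdefPlus], by simp [bound], by simp, fun A _ => by simp [translate]⟩
  | filter φ P x ih =>
    obtain ⟨hw, hwf⟩ := hwf
    obtain ⟨A₀, D, hD, hb, hVD, hT⟩ := ih
      (fun α hα => hcov α (List.mem_cons_of_mem _ hα)) hL.2 hwf
      (fun x hx => hx.elim (hV x) fun h => (hL.2.dep_eq (φ.bound_subset_vdefPlus h)).le) h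
    obtain ⟨a, ha⟩ := hcov ⟨P, x⟩ (by simp [atoms])
    refine ⟨insert a A₀, D, hD, hb, ?_, fun A hA => ?_⟩
    · refine Finset.forall_mem_insert _ _ _ |>.2 ⟨?_, fun b hb' m hm => ?_⟩
      · rw [ha]
        exact fun m _ => (hw m).imp id fun h => hb h
      · rcases hVD b hb' m hm with (h | h) | h
        exacts [.inl h, .inr (hb h), .inr h]
    · rw [translate, if_pos ⟨a, hA (Finset.mem_insert_self _ _), ha⟩]
      exact hT A ((Finset.subset_insert _ _).trans hA)
  | or φ₁ φ₂ ih₁ ih₂ =>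
    have hV' : ∀ x ∈ V ∪ φ₁.bound ∩ φ₂.bound, dep x ≤ n := fun x hx => hx.elim (hV x)
      fun h => (hL.1.dep_eq (φ₁.bound_subset_vdefPlus h.1)).le
    -- One alternative suffices for a nonempty list.
    obtain ⟨A₀, D, hD, hb, hVD, hT⟩ := ih₁
      (fun α hα => hcov α (List.mem_append_left _ hα)) hL.1 hwf.1 hV' h.1
    refine ⟨A₀, D, fun x hx => .inl (hD hx), fun x hx => hb hx.1, fun a ha m hm => ?_,
      fun A hA => ?_⟩
    · rcases hVD a ha m hm with (h | h) | h
      exacts [.inl h, .inr (hb h.1), .inr h]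
    · rw [translate]
      exact List.append_ne_nil_of_left_ne_nil (hT A hA) _
  | seq φ₁ φ₂ ih₁ ih₂ =>
    have hV' : ∀ x ∈ V ∪ (φ₁.bound ∪ φ₂.bound), dep x ≤ n := fun x hx => hx.elim (hV x)
      fun h => h.elim (fun h => (hL.1.dep_eq (φ₁.bound_subset_vdefPlus h)).le)
        fun h => (hL.2.dep_eq (φ₂.bound_subset_vdefPlus h)).le
    obtain ⟨A₁, D₁, hD₁, hb₁, hVD₁, hT₁⟩ := ih₁
      (fun α hα => hcov α (List.mem_append_left _ hα)) hL.1 hwf.1 hV' h.2.1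
    obtain ⟨A₂, D₂, hD₂, hb₂, hVD₂, hT₂⟩ := ih₂
      (fun α hα => hcov α (List.mem_append_right _ hα)) hL.2 hwf.2 hV' h.2.2
    have hdisj : Disjoint D₁ D₂ := Finset.disjoint_coe.1 (h.1.mono hD₁ hD₂)
    refine ⟨A₁ ∪ A₂, D₁ ∪ D₂, ?_, ?_, fun a ha m hm => ?_, fun A hA => ?_⟩
    · rw [Finset.coe_union]
      exact Set.union_subset_union hD₁ hD₂
    · rw [Finset.coe_union]
      exact Set.union_subset_union hb₁ hb₂
    · rw [Finset.coe_union]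
      rcases Finset.mem_union.1 ha with ha | ha
      · rcases hVD₁ a ha m hm with (h | h | h) | h
        exacts [.inl h, .inr (.inl (hb₁ h)), .inr (.inr (hb₂ h)), .inr (.inl h)]
      · rcases hVD₂ a ha m hm with (h | h | h) | h
        exacts [.inl h, .inr (.inl (hb₁ h)), .inr (.inr (hb₂ h)), .inr (.inr h)]
    · obtain ⟨ψ₁, hψ₁⟩ := List.exists_mem_of_ne_nil _ (hT₁ A (Finset.union_subset_left hA))
      obtain ⟨ψ₂, hψ₂⟩ := List.exists_mem_of_ne_nil _ (hT₂ A (Finset.union_subset_right hA))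
      rw [← Finset.union_sdiff_cancel_left hdisj] at hψ₂
      rw [translate]
      refine List.ne_nil_of_mem (a := .seq ψ₁ ψ₂) ?_
      simp only [List.mem_flatMap, Finset.mem_toList, Finset.mem_powerset, List.mem_map]
      exact ⟨D₁, Finset.subset_union_left, ψ₁, hψ₁, ψ₂, hψ₂, rfl⟩
  | plus φ ih =>
    obtain ⟨A', D, hD, hb, hVD, hT⟩ := ih hcov hL hwf
      (fun x hx => (hV x hx.1).trans n.le_succ) h
    refine ⟨A'.filter fun a => ¬ LocalAt atm dep (n + 1) a, ∅, by simp, by simp [bound],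
      fun a ha m hm => ?_, fun A hA => ?_⟩
    · refine (hVD a (Finset.mem_filter.1 ha).1 m (by omega)).elim (fun h => .inl h.1) fun h => ?_
      have := Leveled.dep_eq (φ := φ) hL (hD h)
      omega
    · rw [translate_plus]
      refine SOCEL.plusList_ne_nil (translateBody_ne_nil hD ⟨fun a ha hl => hA (by simp [ha, hl]),
        fun a ha m hm => ?_⟩ (hT A' subset_rfl))
      refine (hVD a ha m hm.le).resolve_left fun h => ?_
      have := hV _ h.1
      omega

end Translation

end FOCEL

/-! ### Renaming variables apart -/

namespace FOCEL

variable {Att : Type a} {𝓡 : CerSchema.{a, u} Att} {Val : Type d} {X : Type v}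
  {𝓑 : Set (FOPredicate (𝓡.Tuples Val))}

/-- Tags every variable with the number of operators `+` around its definition; `ρ` gives the tags
of the variables that are defined outside of the formula, which is in the scope of `n` operators
`+`. -/
noncomputable def tag : FOCEL 𝓡 Val X 𝓑 → ℕ → (X → ℕ) → FOCEL 𝓡 Val (X × ℕ) 𝓑
  | as R x, _, ρ => as R (x, ρ x)
  | filter φ P x, n, ρ => filter (tag φ n ρ) P fun m => (x m, ρ (x m))
  | or φ₁ φ₂, n, ρ => or (tag φ₁ n ρ) (tag φ₂ n ρ)
  | seq φ₁ φ₂, n, ρ => seq (tag φ₁ n ρ) (tag φ₂ n ρ)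
  | plus φ, n, ρ => plus (tag φ (n + 1) (override ρ (fun _ => n + 1) φ.vdefPlus))

/-- The tagged variables of a set. -/
abbrev tagged (ρ : X → ℕ) (V : Set X) : Set (X × ℕ) := (fun x => (x, ρ x)) '' V

theorem tagged_injective (ρ : X → ℕ) : Function.Injective fun x => (x, ρ x) :=
  fun _ _ h => (Prod.ext_iff.1 h).1

theorem tagged_union (ρ : X → ℕ) (V W : Set X) :
    tagged ρ (V ∪ W) = tagged ρ V ∪ tagged ρ W := Set.image_union _ _ _

theorem tagged_inter (ρ : X → ℕ) (V W : Set X) :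
    tagged ρ (V ∩ W) = tagged ρ V ∩ tagged ρ W := Set.image_inter (tagged_injective ρ)

theorem vdefPlus_tag (φ : FOCEL 𝓡 Val X 𝓑) (n : ℕ) (ρ : X → ℕ) :
    (φ.tag n ρ).vdefPlus = tagged ρ φ.vdefPlus := by
  induction φ generalizing n ρ with
  | as R x => simp [tag, vdefPlus]
  | filter φ P x ih => exact ih n ρ
  | or φ₁ φ₂ ih₁ ih₂ => rw [tag, vdefPlus, vdefPlus, ih₁, ih₂, tagged_union]
  | seq φ₁ φ₂ ih₁ ih₂ => rw [tag, vdefPlus, vdefPlus, ih₁, ih₂, tagged_union]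
  | plus φ => simp [tag, vdefPlus]

theorem bound_tag (φ : FOCEL 𝓡 Val X 𝓑) (n : ℕ) (ρ : X → ℕ) :
    (φ.tag n ρ).bound = tagged ρ φ.bound := by
  induction φ generalizing n ρ with
  | as R x => simp [tag, bound]
  | filter φ P x ih => exact ih n ρ
  | or φ₁ φ₂ ih₁ ih₂ =>
    rw [tag, bound, bound, ih₁, ih₂, tagged_inter]
  | seq φ₁ φ₂ ih₁ ih₂ => rw [tag, bound, bound, ih₁, ih₂, tagged_union]
  | plus φ => simp [tag, bound]

theorem Safe.tag {φ : FOCEL 𝓡 Val X 𝓑} (h : φ.Safe) (n : ℕ) (ρ : X → ℕ) : (φ.tag n ρ).Safe := by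
  induction φ generalizing n ρ with
  | as R x => trivial
  | filter φ P x ih => exact ih h n ρ
  | or φ₁ φ₂ ih₁ ih₂ => exact ⟨ih₁ h.1 n ρ, ih₂ h.2 n ρ⟩
  | seq φ₁ φ₂ ih₁ ih₂ =>
    refine ⟨?_, ih₁ h.2.1 n ρ, ih₂ h.2.2 n ρ⟩
    rw [vdefPlus_tag, vdefPlus_tag]
    exact (Set.disjoint_image_iff (tagged_injective ρ)).2 h.1
  | plus φ ih => exact ih h _ _

theorem leveled_tag (φ : FOCEL 𝓡 Val X 𝓑) {n : ℕ} {ρ : X → ℕ} (hρ : ∀ x, ρ x ≤ n)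
    (hφ : ∀ x ∈ φ.vdefPlus, ρ x = n) : (φ.tag n ρ).Leveled Prod.snd n := by
  induction φ generalizing n ρ with
  | as R x => exact hφ x rfl
  | filter φ P x ih => exact ⟨fun m => hρ _, ih hρ hφ⟩
  | or φ₁ φ₂ ih₁ ih₂ =>
    exact ⟨ih₁ hρ fun x hx => hφ x (.inl hx), ih₂ hρ fun x hx => hφ x (.inr hx)⟩
  | seq φ₁ φ₂ ih₁ ih₂ =>
    exact ⟨ih₁ hρ fun x hx => hφ x (.inl hx), ih₂ hρ fun x hx => hφ x (.inr hx)⟩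
  | plus φ ih =>
    refine ih (fun x => ?_) fun x hx => override_of_mem hx
    by_cases hx : x ∈ φ.vdefPlus
    · rw [override_of_mem hx]
    · rw [override_of_notMem hx]
      exact (hρ x).trans n.le_succ

theorem WellFormedIn.mono {φ : FOCEL 𝓡 Val X 𝓑} {V W : Set X} (h : φ.WellFormedIn V)
    (hVW : V ⊆ W) : φ.WellFormedIn W := by
  induction φ generalizing V W with
  | as R x => trivial
  | filter φ P x ih =>
    exact ⟨fun m => (h.1 m).imp (@hVW _) id, ih h.2 (Set.union_subset_union_left _ hVW)⟩
  | or φ₁ φ₂ ih₁ ih₂ =>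
    exact ⟨ih₁ h.1 (Set.union_subset_union_left _ hVW), ih₂ h.2 (Set.union_subset_union_left _ hVW)⟩
  | seq φ₁ φ₂ ih₁ ih₂ =>
    exact ⟨ih₁ h.1 (Set.union_subset_union_left _ hVW), ih₂ h.2 (Set.union_subset_union_left _ hVW)⟩
  | plus φ ih => exact ih h (Set.sdiff_subset_sdiff_left hVW)

theorem WellFormedIn.tag {φ : FOCEL 𝓡 Val X 𝓑} {V : Set X} (h : φ.WellFormedIn V) (n : ℕ)
    (ρ : X → ℕ) : (φ.tag n ρ).WellFormedIn (tagged ρ V) := by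
  induction φ generalizing n ρ V with
  | as R x => trivial
  | filter φ P x ih =>
    have e : tagged ρ V ∪ (φ.tag n ρ).bound = tagged ρ (V ∪ φ.bound) := by
      rw [bound_tag, tagged_union]
    rw [FOCEL.tag, WellFormedIn, e]
    exact ⟨fun m => ⟨_, h.1 m, rfl⟩, ih h.2 n ρ⟩
  | or φ₁ φ₂ ih₁ ih₂ =>
    have e : tagged ρ V ∪ (φ₁.tag n ρ).bound ∩ (φ₂.tag n ρ).bound =
        tagged ρ (V ∪ φ₁.bound ∩ φ₂.bound) := by
      rw [bound_tag, bound_tag, tagged_union, tagged_inter]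
    rw [FOCEL.tag, WellFormedIn, e]
    exact ⟨ih₁ h.1 n ρ, ih₂ h.2 n ρ⟩
  | seq φ₁ φ₂ ih₁ ih₂ =>
    have e : tagged ρ V ∪ ((φ₁.tag n ρ).bound ∪ (φ₂.tag n ρ).bound) =
        tagged ρ (V ∪ (φ₁.bound ∪ φ₂.bound)) := by
      rw [bound_tag, bound_tag, tagged_union, tagged_union]
    rw [FOCEL.tag, WellFormedIn, e]
    exact ⟨ih₁ h.1 n ρ, ih₂ h.2 n ρ⟩
  | plus φ ih =>
    rw [FOCEL.tag, WellFormedIn]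
    -- Outer variables that are not rebound keep their tags, and tagging is injective, so they avoid
    -- the tagged `vdefPlus`.
    refine (ih h _ _).mono ?_
    rintro _ ⟨x, hx, rfl⟩
    refine ⟨⟨x, hx.1, ?_⟩, fun h => hx.2 ?_⟩
    · beta_reduce
      rw [override_of_notMem hx.2]
    · rw [vdefPlus_tag] at h
      exact (tagged_injective _).mem_set_image.1 h

/-- In each scope only the copy `(x, ρ x)` of `x` is visible, so `η` acts through `x ↦ η (x, ρ x)`.
Overriding the tagged variables corresponds to overriding the original ones. -/
theorem sem_tag_iff {φ : FOCEL 𝓡 Val X 𝓑} {S : 𝓡.Streams Val} {i j n : ℕ} {ρ : X → ℕ}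
    {η : X × ℕ → ℕ} {M : Finset ℕ} :
    Sem S (φ.tag n ρ) i j η M ↔ Sem S φ i j (fun x => η (x, ρ x)) M := by
  induction φ generalizing i j n ρ η M with
  | as R x => rw [tag, sem_as_iff, sem_as_iff]
  | filter φ P x ih => rw [tag, sem_filter_iff, sem_filter_iff, ih]
  | or φ₁ φ₂ ih₁ ih₂ => rw [tag, sem_or_iff, sem_or_iff, ih₁, ih₂]
  | seq φ₁ φ₂ ih₁ ih₂ => simp only [tag, sem_seq_iff, ih₁, ih₂]
  | plus φ ih =>
    simp only [tag, sem_plus_iff, ih]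
    set ρ' := override ρ (fun _ => n + 1) φ.vdefPlus with hρ'
    have key (η' : X × ℕ → ℕ) : (fun x => override η η' (φ.tag (n + 1) ρ').vdefPlus (x, ρ' x)) =
        override (fun x => η (x, ρ x)) (fun x => η' (x, n + 1)) φ.vdefPlus := by
      funext x
      have hmem : (x, ρ' x) ∈ (φ.tag (n + 1) ρ').vdefPlus ↔ x ∈ φ.vdefPlus := by
        rw [vdefPlus_tag]
        exact (tagged_injective _).mem_set_image
      by_cases hx : x ∈ φ.vdefPlus
      · rw [override_of_mem (hmem.2 hx), override_of_mem hx, hρ', override_of_mem hx]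
      · rw [override_of_notMem (mt hmem.1 hx), override_of_notMem hx, hρ', override_of_notMem hx]
    simp only [key]
    have e : (fun i j M => ∃ η' : X × ℕ → ℕ,
          Sem S φ i j (override (fun x => η (x, ρ x)) (fun x => η' (x, n + 1)) φ.vdefPlus) M) =
        fun i j M => ∃ ν', Sem S φ i j (override (fun x => η (x, ρ x)) ν' φ.vdefPlus) M := by
      funext i j M
      exact propext ⟨fun ⟨η', h⟩ => ⟨_, h⟩, fun ⟨ν', h⟩ => ⟨fun y => ν' y.1, h⟩⟩
    rw [e]

theorem eval_tag (φ : FOCEL 𝓡 Val X 𝓑) (n : ℕ) (ρ : X → ℕ) (S : 𝓡.Streams Val) (k : ℕ) :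
    (φ.tag n ρ).eval S k = φ.eval S k := by
  ext M
  constructor
  · rintro ⟨η, h⟩
    exact ⟨_, sem_tag_iff.1 h⟩
  · rintro ⟨ν, h⟩
    exact ⟨fun y => ν y.1, sem_tag_iff.2 h⟩

/-! ### Assembling the equivalence -/

/-- The whole formula is treated as one body of depth 0. Every atom is local there, so nothing has
to be asserted outside. -/
theorem eval_eq_supp_image {ι : Type u} [Fintype ι] {atm : ι → Atom X 𝓑} {dep : X → ℕ}
    {φ : FOCEL 𝓡 Val X 𝓑} (h2 : ∀ a, (atm a).1.1.arity ≤ 2)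
    (hcov : ∀ α ∈ φ.atoms, ∃ a, atm a = α) (hL : φ.Leveled dep 0) (hwf : φ.WellFormed)
    (S : 𝓡.Streams Val) (k : ℕ) :
    φ.eval S k =
      ComplexEvent.supp '' {C | ∃ ψ ∈ translateBody atm dep φ 0 ∅, SOCEL.Sem S ψ 0 k C} := by
  ext M
  simp only [exists_sem_translateBody_iff, Set.mem_image, Set.mem_ofPred_eq]
  constructor
  · rintro ⟨ν, h⟩
    rw [← override_self ν φ.vdefPlus] at h
    obtain ⟨A₀, hA₀, -, -, hC⟩ := (h.completeAt h2 hcov hL hwf (by simp)).body hL (by simp)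
    obtain ⟨C, hC, hs, -⟩ := hC ∅ fun a ha => absurd (fun m => Nat.zero_le _) (hA₀ a ha)
    exact ⟨C, hC, hs⟩
  · rintro ⟨C, hC, rfl⟩
    obtain ⟨ν, h⟩ := (hC.sound (TrSem.sound hL) hL).2 (fun _ => 0) (by simp)
    exact ⟨_, h⟩

/-- Over predicates of arity at most two, a well-formed formula that is safe or satisfiable is
equivalent to a second-order formula over the universal extensions. -/
theorem exists_celEquiv (h𝓑 : ∀ P ∈ 𝓑, P.arity ≤ 2) (φ : FOCEL 𝓡 Val X 𝓑) (hwf : φ.WellFormed)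
    (hφ : φ.Safe ∨ φ.Satisfiable) :
    ∃ (Λ : LabelSet 𝓡) (ψ : SOCEL 𝓡 Val Λ (FOPredicate.extSet 𝓑)), CelEquiv φ ψ := by
  set χ := φ.tag 0 fun _ => 0 with hχ
  -- Atoms are indexed by their occurrences; the lift places the labels in the universe of the
  -- relation names.
  let atm : ULift.{u} (Fin χ.atoms.length) → Atom (X × ℕ) 𝓑 := fun a => χ.atoms.get a.down
  have h2 : ∀ a, (atm a).1.1.arity ≤ 2 := fun a => h𝓑 _ (atm a).1.2
  have hcov : ∀ α ∈ χ.atoms, ∃ a, atm a = α := fun α hα => by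
    obtain ⟨n, h⟩ := List.get_of_mem hα
    exact ⟨⟨n⟩, h⟩
  have hL : χ.Leveled Prod.snd 0 := leveled_tag φ (fun _ => le_rfl) fun _ _ => rfl
  have hχwf : χ.WellFormedIn ∅ := by
    have := WellFormedIn.tag hwf 0 fun _ => 0
    rwa [tagged, Set.image_empty] at this
  have heval := eval_eq_supp_image h2 hcov hL hχwf
  have hne : translateBody atm Prod.snd χ 0 ∅ ≠ [] := by
    rcases hφ with hφ | ⟨S, n, M, hM⟩
    · obtain ⟨A₀, D, hD, -, hA₀, hT⟩ :=
        (hφ.tag 0 fun _ => 0).exists_translate_ne_nil hcov hL hχwf (by simp)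
      exact translateBody_ne_nil hD ⟨fun a _ hl => absurd (fun m => Nat.zero_le _) hl,
        fun a ha m hm => (hA₀ a ha m hm.le).resolve_left fun h => h⟩ (hT A₀ subset_rfl)
    -- A match is the support of a complex event of some formula in the list.
    · rw [← eval_tag φ 0 (fun _ => 0), ← hχ, heval] at hM
      obtain ⟨C, ⟨ψ, hψ, -⟩, -⟩ := hM
      exact List.ne_nil_of_mem hψ
  obtain ⟨ψ, l, hl⟩ := List.exists_cons_of_ne_nil hne
  refine ⟨atomLabels atm, .orList ψ l, fun S n => ?_⟩
  rw [← eval_tag φ 0 (fun _ => 0), ← hχ, heval, hl]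
  simp only [SOCEL.eval, SOCEL.sem_orList_iff]

end FOCEL

theorem mainTheorem5 :
    (∀ (Att : Type a) (Val : Type d) (𝓡 : CerSchema.{a, u} Att) (X : Type v)
        (𝓑 : Set (FOPredicate (𝓡.Tuples Val))), (∀ P ∈ 𝓑, P.arity ≤ 2) →
      ∀ φ : FOCEL 𝓡 Val X 𝓑, φ.WellFormed → (φ.Safe ∨ φ.Satisfiable) →
        ∃ (Λ : LabelSet 𝓡) (ψ : SOCEL 𝓡 Val Λ (FOPredicate.extSet 𝓑)), CelEquiv φ ψ) ∧
    (∃ (𝓡 : CerSchema.{0, 0} ℕ) (P : FOPredicate (𝓡.Tuples ℕ)), P.arity = 2 ∧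
      ∃ (Λ : LabelSet 𝓡) (ψ : SOCEL 𝓡 ℕ Λ (FOPredicate.extSet {P})),
        ∀ (X : Type v) (φ : FOCEL 𝓡 ℕ X {P}), ¬ CelEquiv φ ψ) :=
  ⟨fun _ _ _ _ _ h𝓑 φ hwf hφ => φ.exists_celEquiv h𝓑 hwf hφ,
    unarySchema, notSuccPredicate, rfl, unaryLabels, notSuccFormula,
    fun _ φ => not_celEquiv_notSuccFormula φ⟩
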